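/- All rings are commutative and Noetherian, and "finite module" means finitely generated module. A finite module $N$ over a local ring $R$ is called maximal Cohen-Macaulay (MCM) if $\operatorname{depth} N = \dim R$; since $\operatorname{depth} 0 = +\infty$, the zero module is not MCM. For a finite $R$-module $M$, let $\Omega_0^R M = M$ and, for $s \ge 1$, let $\Omega_s^R M$ be the image of the $s$-th differential $F_s \to F_{s-1}$ in a minimal free resolution $\cdots \to F_1 \to F_0 \to M \to 0$ of $M$. **Corollary.** Let $R$ be a Cohen-Macaulay local ring possessing a canonical module $\omega_R$, and write $X^\vee = \operatorname{Hom}_R(X, \omega_R)$. Let $M$ and $N$ be finite $R$-modules with $N$ maximal Cohen-Macaulay, and let $n \ge 1$ be an integer. Assume that, for each $j = 0, \ldots, n-1$, the $R$-module $\operatorname{Tor}_j^R(M, N^\vee)$ is either zero or maximal Cohen-Macaulay. Then the following assertions hold. (i) Suppose $\operatorname{Tor}_n^R(M, N^\vee) = 0$. Then $\operatorname{Ext}^n_R(M, N) = 0$ and $$\operatorname{Ext}^{n+1}_R(M, N) \cong \operatorname{Tor}_{n+1}^R(M, N^\vee)^\vee.$$ (ii) Suppose $\operatorname{Tor}_n^R(M,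 N^\vee) \ne 0$. If both $\Omega_{n-1}^R M \otimes_R N^\vee$ and $\Omega_n^R M \otimes_R N^\vee$ are maximal Cohen-Macaulay, then $\operatorname{Tor}_n^R(M, N^\vee)$ is maximal Cohen-Macaulay as well, and $$\operatorname{Ext}^j_R(M, N) \cong \operatorname{Tor}_j^R(M, N^\vee)^\vee \quad \text{for all } j = 0, \ldots, n+1.$$ In particular, $\operatorname{Ext}^n_R(M, N) \ne 0$. -/

import Mathlib

open CategoryTheory IsLocalRing
open scoped TensorProduct

universe u

noncomputable section

/-- The depth of a module over a local ring: the supremum of the lengths of the sequences of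
elements of the maximal ideal that are weakly regular on `M`. For a nonzero finite module
over a Noetherian local ring, such sequences are exactly the regular ones, by Nakayama's lemma.
For `M = 0` every sequence is weakly regular, so that `depth 0 = ∞`. -/
def moduleDepth (R : Type u) [CommRing R] [IsLocalRing R]
    (M : Type u) [AddCommGroup M] [Module R M] : ℕ∞ :=
  ⨆ (rs : List R) (_ : ∀ r ∈ rs, r ∈ maximalIdeal R)
    (_ : RingTheory.Sequence.IsWeaklyRegular M rs), (rs.length : ℕ∞)

/-- Maximal Cohen-Macaulay modules: finite modules with `depth M = dim R`. Over a Noetherian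
local ring the zero module is not maximal Cohen-Macaulay, as its depth is infinite. -/
structure IsMCM (R : Type u) [CommRing R] [IsLocalRing R]
    (M : Type u) [AddCommGroup M] [Module R M] : Prop where
  finite : Module.Finite R M
  depth_eq : ((moduleDepth R M : ℕ∞) : WithBot ℕ∞) = ringKrullDim R

/-- Cohen-Macaulay local rings: Noetherian local rings with `depth R = dim R`. -/
structure IsCMLocalRing (R : Type u) [CommRing R] [IsLocalRing R] : Prop where
  noetherian : IsNoetherianRing R
  depth_eq : ((moduleDepth R R : ℕ∞) : WithBot ℕ∞) = ringKrullDim R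

/-- Canonical modules of a Cohen-Macaulay local ring `R` with residue field `k`: the maximal
Cohen-Macaulay modules `ω` of finite injective dimension and of type one. Here the type of `ω`
is the dimension over `k` of `Ext^d(k, ω)` with `d = depth ω = dim R`; it is one if and only if
this module, which is killed by the maximal ideal, is isomorphic to `k`. -/
structure IsCanonicalModule (R : Type u) [CommRing R] [IsLocalRing R]
    (ω : Type u) [AddCommGroup ω] [Module R ω] : Prop where
  isMCM : IsMCM R ω
  finite_injectiveDimension :
    ∃ m : ℕ, HasInjectiveDimensionLE (ModuleCat.of R ω) m
  type_eq_one : ∃ d : ℕ, ringKrullDim R = d ∧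
    Nonempty (Abelian.Ext.{u} (ModuleCat.of R (ResidueField R)) (ModuleCat.of R ω) d
      ≃ₗ[R] ResidueField R)

/-- The module `Ext^j_R(M, N)`. -/
abbrev ExtMod (R : Type u) [CommRing R] (j : ℕ) (M N : Type u)
    [AddCommGroup M] [Module R M] [AddCommGroup N] [Module R N] : Type u :=
  Abelian.Ext.{u} (ModuleCat.of R M) (ModuleCat.of R N) j

/-- The module `Tor_j^R(M, N)`: the `j`-th left derived functor of `- ⊗ N`, applied to `M`. -/
abbrev TorMod (R : Type u) [CommRing R] (j : ℕ) (M N : Type u)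
    [AddCommGroup M] [Module R M] [AddCommGroup N] [Module R N] : Type u :=
  (((Tor' (ModuleCat.{u} R) j).obj (ModuleCat.of R M)).obj (ModuleCat.of R N) : ModuleCat.{u} R)

/-- A projective resolution `⋯ → F₁ → F₀ → M → 0` over a local ring is a minimal free resolution
(by finite modules) if each `Fᵢ` is finite free and each differential has image in `𝔪 Fᵢ`. -/
structure IsMinimalFreeResolution {R : Type u} [CommRing R] [IsLocalRing R]
    {M : ModuleCat.{u} R} (F : ProjectiveResolution M) : Prop where
  free : ∀ i, Module.Free R (F.complex.X i)
  finite : ∀ i, Module.Finite R (F.complex.X i)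
  minimal : ∀ i, LinearMap.range (F.complex.d (i + 1) i).hom ≤
    maximalIdeal R • (⊤ : Submodule R (F.complex.X i))

/-- The syzygies read off a resolution `F` of `M`: `Ω₀ = M`, and `Ω_s` is the image of the `s`-th
differential `F_s → F_{s-1}` for `s ≥ 1`. -/
def syzygy {R : Type u} [CommRing R] {M : ModuleCat.{u} R} (F : ProjectiveResolution M) :
    ℕ → ModuleCat.{u} R
  | 0 => M
  | s + 1 => ModuleCat.of R (LinearMap.range (F.complex.d (s + 1) s).hom)

end

/-!
A module of maximal depth is acyclic for `Hom(-, ω)` and equal to its double dual: a maximal regular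
sequence reduces both facts to the duality of finite length modules into `ω / Iω`, which is the
injective hull of the residue field of `R / I`. In particular `N = Hom(N^∨, ω)`, so that maps
`P → N` are forms on `P ⊗ N^∨`. With `0 → Ω_{p+1} → F_p → Ω_p → 0`, this identifies
`Ext^{p+1}(M, N) = Ext^1(Ω_p, N)` with the cokernel of the dual of the map
`Ω_{p+1} ⊗ N^∨ → F_p ⊗ N^∨`, whose kernel is `Tor_{p+1}(M, N^∨)`. As long as the lower `Tor_j` are
acyclic for `Hom(-, ω)`, so are `Ω_p ⊗ N^∨` and the image of this map; hence the cokernel of its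
dual is the dual of its kernel. In (ii), the depth lemma applied to
`0 → Tor_n → Ω_n ⊗ N^∨ → F_{n-1} ⊗ N^∨ → Ω_{n-1} ⊗ N^∨ → 0` makes `Tor_n` maximal Cohen-Macaulay,
and `Tor_n`, being reflexive and nonzero, has a nonzero dual.
-/

section Ext

open Abelian

variable {R : Type u} [CommRing R] {A B C L W : Type u}
  [AddCommGroup A] [Module R A] [AddCommGroup B] [Module R B] [AddCommGroup C] [Module R C]
  [AddCommGroup L] [Module R L] [AddCommGroup W] [Module R W]

theorem shortExact_of_exact {f : A →ₗ[R] B} {g : B →ₗ[R] C} (hf : Function.Injective f)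
    (hg : Function.Surjective g) (h : Function.Exact f g) :
    (ModuleCat.shortComplexOfCompEqZero f g h.linearMap_comp_eq_zero).ShortExact :=
  ModuleCat.shortComplex_shortExact _ h hf hg

namespace ExtMod

theorem subsingleton_of_retract_left {i : A →ₗ[R] B} {p : B →ₗ[R] A} (h : p ∘ₗ i = LinearMap.id)
    {n : ℕ} (hB : Subsingleton (ExtMod R n B W)) : Subsingleton (ExtMod R n A W) := by
  refine subsingleton_of_forall_eq 0 fun x ↦ ?_
  have hx : (Ext.mk₀ (ModuleCat.ofHom i)).comp
      ((Ext.mk₀ (ModuleCat.ofHom p)).comp x (zero_add n)) (zero_add n) = x := by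
    rw [Ext.mk₀_comp_mk₀_assoc, ← ModuleCat.ofHom_comp, h]
    exact Ext.mk₀_id_comp x
  rw [← hx, hB.elim (Ext.comp _ x _) 0, Ext.comp_zero]

theorem subsingleton_congr (e : A ≃ₗ[R] B) {n : ℕ} :
    Subsingleton (ExtMod R n A W) ↔ Subsingleton (ExtMod R n B W) :=
  ⟨subsingleton_of_retract_left e.comp_symm, subsingleton_of_retract_left e.symm_comp⟩

theorem subsingleton_of_projective [Module.Projective R A] (n : ℕ) :
    Subsingleton (ExtMod R (n + 1) A W) :=
  have : Projective (ModuleCat.of R A) := (IsProjective.iff_projective A).mp inferInstance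
  Ext.subsingleton_of_projective _ _ n

theorem subsingleton_of_subsingleton_left [Subsingleton A] (n : ℕ) :
    Subsingleton (ExtMod R n A W) := by
  refine subsingleton_of_forall_eq 0 fun x ↦ ?_
  have : 𝟙 (ModuleCat.of R A) = 0 := by
    ext a
    exact Subsingleton.elim _ _
  rw [← Ext.mk₀_id_comp x, this, Ext.mk₀_zero, Ext.zero_comp]

theorem subsingleton_of_subsingleton_right [Subsingleton W] (n : ℕ) :
    Subsingleton (ExtMod R n A W) := by
  refine subsingleton_of_forall_eq 0 fun x ↦ ?_
  have : 𝟙 (ModuleCat.of R W) = 0 := by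
    ext a
    exact Subsingleton.elim _ _
  rw [← Ext.comp_mk₀_id x, this, Ext.mk₀_zero, Ext.comp_zero]

/-- The identification of `Ext⁰(A, W)` with `Hom(A, W)`. -/
noncomputable def zeroEquiv : ExtMod R 0 A W ≃ₗ[R] (A →ₗ[R] W) :=
  Ext.linearEquiv₀.trans ModuleCat.homLinearEquiv

section ShortExact

variable {f : A →ₗ[R] B} {g : B →ₗ[R] C} (hf : Function.Injective f)
  (hg : Function.Surjective g) (h : Function.Exact f g)
include hf hg h

theorem contravariant_subsingleton₁ {n : ℕ} (hB : Subsingleton (ExtMod R n B W))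
    (hC : Subsingleton (ExtMod R (n + 1) C W)) : Subsingleton (ExtMod R n A W) := by
  refine subsingleton_of_forall_eq 0 fun x ↦ ?_
  obtain ⟨y, rfl⟩ := Ext.contravariant_sequence_exact₁ (shortExact_of_exact hf hg h)
    (ModuleCat.of R W) x (add_comm 1 n) (hC.elim _ _)
  rw [hB.elim y 0, Ext.comp_zero]

theorem contravariant_subsingleton₂ {n : ℕ} (hA : Subsingleton (ExtMod R n A W))
    (hC : Subsingleton (ExtMod R n C W)) : Subsingleton (ExtMod R n B W) := by
  refine subsingleton_of_forall_eq 0 fun x ↦ ?_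
  obtain ⟨y, rfl⟩ := Ext.contravariant_sequence_exact₂ (shortExact_of_exact hf hg h)
    (ModuleCat.of R W) x (hA.elim _ _)
  rw [hC.elim y 0, Ext.comp_zero]

theorem contravariant_subsingleton₃ {n : ℕ} (hA : Subsingleton (ExtMod R n A W))
    (hB : Subsingleton (ExtMod R (n + 1) B W)) : Subsingleton (ExtMod R (n + 1) C W) := by
  refine subsingleton_of_forall_eq 0 fun x ↦ ?_
  obtain ⟨y, rfl⟩ := Ext.contravariant_sequence_exact₃ (shortExact_of_exact hf hg h)
    (ModuleCat.of R W) x (hB.elim _ _) (add_comm 1 n)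
  rw [hA.elim y 0, Ext.comp_zero]

theorem covariant_subsingleton₁ {n : ℕ} (hC : Subsingleton (ExtMod R n L C))
    (hB : Subsingleton (ExtMod R (n + 1) L B)) : Subsingleton (ExtMod R (n + 1) L A) := by
  refine subsingleton_of_forall_eq 0 fun x ↦ ?_
  obtain ⟨y, rfl⟩ := Ext.covariant_sequence_exact₁ _ (shortExact_of_exact hf hg h) x
    (hB.elim _ _) rfl
  rw [hC.elim y 0, Ext.zero_comp]

theorem covariant_subsingleton₂ {n : ℕ} (hA : Subsingleton (ExtMod R n L A))
    (hC : Subsingleton (ExtMod R n L C)) : Subsingleton (ExtMod R n L B) := by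
  refine subsingleton_of_forall_eq 0 fun x ↦ ?_
  obtain ⟨y, rfl⟩ := Ext.covariant_sequence_exact₂ _ (shortExact_of_exact hf hg h) x (hC.elim _ _)
  rw [hA.elim y 0, Ext.zero_comp]

theorem covariant_subsingleton₃ {n : ℕ} (hB : Subsingleton (ExtMod R n L B))
    (hA : Subsingleton (ExtMod R (n + 1) L A)) : Subsingleton (ExtMod R n L C) := by
  refine subsingleton_of_forall_eq 0 fun x ↦ ?_
  obtain ⟨y, rfl⟩ := Ext.covariant_sequence_exact₃ _ (shortExact_of_exact hf hg h) x rfl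
    (hA.elim _ _)
  rw [hB.elim y 0, Ext.zero_comp]

theorem exists_extension_of_extClass_comp_eq_zero (φ : A →ₗ[R] W)
    (hφ : (shortExact_of_exact hf hg h).extClass.comp (Ext.mk₀ (ModuleCat.ofHom φ))
      (add_zero 1) = 0) : ∃ ψ : B →ₗ[R] W, ψ ∘ₗ f = φ := by
  obtain ⟨y, hy⟩ := Ext.contravariant_sequence_exact₁ (shortExact_of_exact hf hg h)
    (ModuleCat.of R W) _ (add_zero 1) hφ
  obtain ⟨ψ, rfl⟩ := (Ext.mk₀_bijective _ _).2 y
  rw [Ext.mk₀_comp_mk₀] at hy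
  exact ⟨ψ.hom, congr_arg ModuleCat.Hom.hom ((Ext.mk₀_bijective _ _).1 hy)⟩

theorem exists_extension (hC : Subsingleton (ExtMod R 1 C W)) (φ : A →ₗ[R] W) :
    ∃ ψ : B →ₗ[R] W, ψ ∘ₗ f = φ :=
  exists_extension_of_extClass_comp_eq_zero hf hg h φ (hC.elim _ _)

theorem exists_lift (hA : Subsingleton (ExtMod R 1 L A)) (φ : L →ₗ[R] C) :
    ∃ ψ : L →ₗ[R] B, g ∘ₗ ψ = φ := by
  obtain ⟨y, hy⟩ := Ext.covariant_sequence_exact₃ (ModuleCat.of R L)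
    (shortExact_of_exact hf hg h) (Ext.mk₀ (ModuleCat.ofHom φ)) (zero_add 1) (hA.elim _ _)
  obtain ⟨ψ, rfl⟩ := (Ext.mk₀_bijective _ _).2 y
  rw [Ext.mk₀_comp_mk₀] at hy
  exact ⟨ψ.hom, congr_arg ModuleCat.Hom.hom ((Ext.mk₀_bijective _ _).1 hy)⟩

theorem nonempty_dimensionShift {n : ℕ} (hB : Subsingleton (ExtMod R n B W))
    (hB' : Subsingleton (ExtMod R (n + 1) B W)) :
    Nonempty (ExtMod R n A W ≃ₗ[R] ExtMod R (n + 1) C W) := by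
  have hS := shortExact_of_exact hf hg h
  refine ⟨.ofBijective (Ext.precompOfLinear hS.extClass R (ModuleCat.of R W) (add_comm 1 n))
    ⟨(injective_iff_map_eq_zero _).mpr fun x hx ↦ ?_, fun y ↦ ?_⟩⟩
  · obtain ⟨y, rfl⟩ := Ext.contravariant_sequence_exact₁ hS (ModuleCat.of R W) x (add_comm 1 n) hx
    rw [hB.elim y 0, Ext.comp_zero]
  · exact Ext.contravariant_sequence_exact₃ hS (ModuleCat.of R W) y (hB'.elim _ _) (add_comm 1 n)

theorem nonempty_one_equiv_quotient_range_lcomp (hB : Subsingleton (ExtMod R 1 B W)) :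
    Nonempty (ExtMod R 1 C W ≃ₗ[R] (A →ₗ[R] W) ⧸ LinearMap.range (f.lcomp R W)) := by
  have hS := shortExact_of_exact hf hg h
  let δ : (A →ₗ[R] W) →ₗ[R] ExtMod R 1 C W :=
    Ext.precompOfLinear hS.extClass R (ModuleCat.of R W) (add_zero 1) ∘ₗ zeroEquiv.symm.toLinearMap
  have hδ (φ : A →ₗ[R] W) :
      δ φ = hS.extClass.comp (Ext.mk₀ (ModuleCat.ofHom φ)) (add_zero 1) := rfl
  have hsurj : Function.Surjective δ := fun y ↦ by
    obtain ⟨x, hx⟩ := Ext.contravariant_sequence_exact₃ hS (ModuleCat.of R W) y (hB.elim _ _)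
      (add_zero 1)
    obtain ⟨φ, rfl⟩ := (Ext.mk₀_bijective _ _).2 x
    exact ⟨φ.hom, hx⟩
  have hker : LinearMap.range (f.lcomp R W) = LinearMap.ker δ := by
    refine le_antisymm ?_ fun φ hφ ↦ exists_extension_of_extClass_comp_eq_zero hf hg h φ hφ
    rintro _ ⟨ψ, rfl⟩
    have hψ : δ (ψ ∘ₗ f) = 0 := by
      rw [hδ, ModuleCat.ofHom_comp, ← Ext.mk₀_comp_mk₀]
      exact hS.extClass_comp_assoc _
    exact hψ
  exact ⟨((Submodule.quotEquivOfEq _ _ hker).trans (δ.quotKerEquivOfSurjective hsurj)).symm⟩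

end ShortExact

end ExtMod

end Ext

section Grade

open Abelian Pointwise RingTheory.Sequence

variable {R : Type u} [CommRing R] {A B C L X : Type u} [AddCommGroup A] [Module R A]
  [AddCommGroup B] [Module R B] [AddCommGroup C] [Module R C] [AddCommGroup L] [Module R L]
  [AddCommGroup X] [Module R X]

/-- The grade of `L` on `X` is at least `d`: the modules `Ext^i(L, X)` vanish for `i < d`. By a
theorem of Rees, if `X` is a finite module over a Noetherian local ring and `L` is the residue
field, this means that `X` has depth at least `d`. -/
def GradeGE (R : Type u) [CommRing R] (d : ℕ) (L X : Type u) [AddCommGroup L] [Module R L]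
    [AddCommGroup X] [Module R X] : Prop :=
  ∀ i < d, Subsingleton (ExtMod R i L X)

theorem isWeaklyRegular_of_subsingleton [Subsingleton X] (rs : List R) : IsWeaklyRegular X rs := by
  induction rs generalizing X with
  | nil => exact .nil R X
  | cons r rs ih => exact .cons (fun a b _ ↦ Subsingleton.elim a b) ih

theorem shortExact_lsmul_mkQ {x : R} (hx : IsSMulRegular X x) :
    (ModuleCat.shortComplexOfCompEqZero (LinearMap.lsmul R X x) (x • (⊤ : Submodule R X)).mkQ
      (LinearMap.exact_lsmul_mkQ_smul_top X x).linearMap_comp_eq_zero).ShortExact :=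
  shortExact_of_exact (f := LinearMap.lsmul R X x) hx (Submodule.mkQ_surjective _)
    (LinearMap.exact_lsmul_mkQ_smul_top X x)

theorem exists_comp_extClass_lsmul_mkQ_eq {x : R} (hx : IsSMulRegular X x)
    (hL : x ∈ Module.annihilator R L) {n : ℕ} (z : ExtMod R (n + 1) L X) :
    ∃ y : ExtMod R n L (QuotSMulTop x X), y.comp (shortExact_lsmul_mkQ hx).extClass rfl = z :=
  Ext.covariant_sequence_exact₁ (ModuleCat.of R L) (shortExact_lsmul_mkQ hx) z
    (congr_arg (fun φ ↦ φ.hom z) (Ext.postcomp_smul_id_eq_zero_of_mem_annihilator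
      (M := ModuleCat.of R X) hL (n + 1))) rfl

theorem comp_extClass_lsmul_mkQ_bijective {x : R} (hx : IsSMulRegular X x)
    (hL : x ∈ Module.annihilator R L) {n : ℕ} (h : Subsingleton (ExtMod R n L X)) :
    Function.Bijective fun y : ExtMod R n L (QuotSMulTop x X) ↦
      (y.comp (shortExact_lsmul_mkQ hx).extClass rfl : ExtMod R (n + 1) L X) := by
  refine ⟨?_, exists_comp_extClass_lsmul_mkQ_eq hx hL⟩
  refine (injective_iff_map_eq_zero ((shortExact_lsmul_mkQ hx).extClass.postcomp
    (ModuleCat.of R L) rfl)).mpr fun y hy ↦ ?_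
  obtain ⟨z, hz⟩ := Ext.covariant_sequence_exact₃ (ModuleCat.of R L) (shortExact_lsmul_mkQ hx) y
    rfl hy
  rw [← hz, h.elim z 0, Ext.zero_comp]

namespace GradeGE

theorem of_isWeaklyRegular {rs : List R} (hL : ∀ r ∈ rs, r ∈ Module.annihilator R L)
    (hr : IsWeaklyRegular X rs) : GradeGE R rs.length L X := by
  induction rs generalizing X with
  | nil => exact fun i hi ↦ absurd hi i.not_lt_zero
  | cons x rs ih =>
    obtain ⟨hx, hL⟩ := List.forall_mem_cons.mp hL
    obtain ⟨hreg, hr⟩ := (isWeaklyRegular_cons_iff X x rs).mp hr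
    rintro (_ | i) hi
    · have := hreg.linearMap_subsingleton_of_mem_annihilator hx (N := L)
      exact ExtMod.zeroEquiv.subsingleton
    · refine subsingleton_of_forall_eq 0 fun z ↦ ?_
      obtain ⟨y, rfl⟩ := exists_comp_extClass_lsmul_mkQ_eq hreg hx z
      rw [(ih hL hr i (Nat.lt_of_succ_lt_succ hi)).elim y 0, Ext.zero_comp]

theorem prod {d : ℕ} (hA : GradeGE R d L A) (hB : GradeGE R d L B) : GradeGE R d L (A × B) :=
  fun i hi ↦ ExtMod.covariant_subsingleton₂ (f := .inl R A B) (g := .snd R A B)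
    LinearMap.inl_injective LinearMap.snd_surjective .inl_snd (hA i hi) (hB i hi)

theorem left {d : ℕ} {f : A →ₗ[R] B} {g : B →ₗ[R] C} (hf : Function.Injective f)
    (hg : Function.Surjective g) (h : Function.Exact f g) (hB : GradeGE R d L B)
    (hC : GradeGE R (d - 1) L C) : GradeGE R d L A := by
  rintro (_ | i) hi
  · have := hB 0 hi
    have hLB : Subsingleton (L →ₗ[R] B) := (ExtMod.zeroEquiv (R := R)).symm.subsingleton
    have : Subsingleton (L →ₗ[R] A) :=
      ⟨fun φ ψ ↦ (LinearMap.cancel_left hf).mp (hLB.elim _ _)⟩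
    exact (ExtMod.zeroEquiv (R := R)).subsingleton
  · exact ExtMod.covariant_subsingleton₁ hf hg h (hC i (by omega)) (hB (i + 1) hi)

end GradeGE

end Grade

section Depth

open Pointwise RingTheory.Sequence

variable {R : Type u} [CommRing R] [IsLocalRing R] {X Y : Type u}
  [AddCommGroup X] [Module R X] [AddCommGroup Y] [Module R Y]

theorem natCast_le_moduleDepth_iff {n : ℕ} : (n : ℕ∞) ≤ moduleDepth R X ↔
    ∃ rs : List R, rs.length = n ∧ (∀ r ∈ rs, r ∈ maximalIdeal R) ∧ IsWeaklyRegular X rs := by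
  constructor
  · intro h
    have : ∃ rs : List R, n ≤ rs.length ∧ (∀ r ∈ rs, r ∈ maximalIdeal R) ∧
        IsWeaklyRegular X rs := by
      by_contra! hlt
      cases n with
      | zero => exact hlt [] le_rfl (by simp) (.nil R X)
      | succ n =>
        have : moduleDepth R X ≤ n := iSup_le fun rs ↦ iSup_le fun hm ↦ iSup_le fun hr ↦ by
          by_contra! hn
          exact hlt rs (by exact_mod_cast Order.add_one_le_of_lt hn) hm hr
        exact absurd (h.trans this) (by exact_mod_cast Nat.not_succ_le_self n)
    obtain ⟨rs, hn, hm, hr⟩ := this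
    refine ⟨rs.take n, by simpa, fun r hr ↦ hm r (List.mem_of_mem_take hr), ?_⟩
    rw [← List.take_append_drop n rs, isWeaklyRegular_append_iff] at hr
    exact hr.1
  · rintro ⟨rs, rfl, hm, hr⟩
    exact le_iSup_of_le rs (le_iSup_of_le hm (le_iSup_of_le hr le_rfl))

theorem exists_isWeaklyRegular_of_subsingleton [Subsingleton X] (n : ℕ) :
    ∃ rs : List R, rs.length = n ∧ (∀ r ∈ rs, r ∈ maximalIdeal R) ∧ IsWeaklyRegular X rs := by
  refine ⟨List.replicate n 0, List.length_replicate, fun r hr ↦ ?_,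
    isWeaklyRegular_of_subsingleton _⟩
  rw [List.eq_of_mem_replicate hr]
  exact zero_mem _

theorem moduleDepth_eq_top_of_subsingleton [Subsingleton X] : moduleDepth R X = ⊤ :=
  ENat.eq_top_iff_forall_ge.mpr fun n ↦
    natCast_le_moduleDepth_iff.mpr (exists_isWeaklyRegular_of_subsingleton n)

theorem annihilator_residueField : Module.annihilator R (ResidueField R) = maximalIdeal R :=
  Ideal.annihilator_quotient

theorem exists_isWeaklyRegular_iff_gradeGE [IsNoetherianRing R] [Module.Finite R X] {n : ℕ} :
    (∃ rs : List R, rs.length = n ∧ (∀ r ∈ rs, r ∈ maximalIdeal R) ∧ IsWeaklyRegular X rs) ↔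
      GradeGE R n (ResidueField R) X := by
  constructor
  · rintro ⟨rs, rfl, hm, hr⟩
    exact .of_isWeaklyRegular (by rwa [annihilator_residueField]) hr
  · intro h
    cases subsingleton_or_nontrivial X
    · exact exists_isWeaklyRegular_of_subsingleton n
    have hlt : maximalIdeal R • (⊤ : Submodule R X) < ⊤ :=
      (Submodule.top_ne_ideal_smul_of_le_jacobson_annihilator
        (maximalIdeal_le_jacobson _)).symm.lt_top
    have hsupp : Module.support R (ResidueField R) =
        PrimeSpectrum.zeroLocus (maximalIdeal R : Set R) := by
      rw [Module.support_eq_zeroLocus, annihilator_residueField]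
    obtain ⟨rs, hl, hm, hr⟩ := ModuleCat.exists_isRegular_of_exists_subsingleton_ext
      (maximalIdeal R) n (ModuleCat.of R X) hlt (ModuleCat.of R (ResidueField R)) hsupp h
    exact ⟨rs, hl, hm, hr.1⟩

theorem natCast_le_moduleDepth_iff_gradeGE [IsNoetherianRing R] [Module.Finite R X] {n : ℕ} :
    (n : ℕ∞) ≤ moduleDepth R X ↔ GradeGE R n (ResidueField R) X :=
  natCast_le_moduleDepth_iff.trans exists_isWeaklyRegular_iff_gradeGE

theorem moduleDepth_le_ringKrullDim [IsNoetherianRing R] [Module.Finite R X] [Nontrivial X] :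
    (moduleDepth R X : WithBot ℕ∞) ≤ ringKrullDim R := by
  obtain ⟨d, hd⟩ : ∃ d : ℕ∞, ringKrullDim R = d :=
    (WithBot.ne_bot_iff_exists.mp ringKrullDim_ne_bot).imp fun _ ↦ Eq.symm
  rw [hd, WithBot.coe_le_coe]
  refine iSup_le fun rs ↦ iSup_le fun hm ↦ iSup_le fun hr ↦ ?_
  have hreg := IsRegular.of_isWeaklyRegular_of_mem_maximalIdeal X hm hr
  have : Nontrivial (X ⧸ Ideal.ofList rs • (⊤ : Submodule R X)) :=
    hreg.quot_ofList_smul_nontrivial _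
  obtain ⟨a, ha⟩ := WithBot.ne_bot_iff_exists.mp ((Module.supportDim_ne_bot_iff_nontrivial R
    (X ⧸ Ideal.ofList rs • (⊤ : Submodule R X))).mpr this)
  have hle := Module.supportDim_le_ringKrullDim R X
  rw [← Module.supportDim_add_length_eq_supportDim_of_isRegular rs hreg, ← ha, hd] at hle
  exact le_add_self.trans (by exact_mod_cast hle)

theorem isMCM_iff [IsNoetherianRing R] [Module.Finite R X] {d : ℕ} (hd : ringKrullDim R = d) :
    IsMCM R X ↔ Nontrivial X ∧ GradeGE R d (ResidueField R) X := by
  rw [← natCast_le_moduleDepth_iff_gradeGE]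
  constructor
  · intro h
    have hX : moduleDepth R X = d := by exact_mod_cast h.depth_eq.trans hd
    refine ⟨not_subsingleton_iff_nontrivial.mp fun _ ↦ ?_, hX.ge⟩
    exact ENat.natCast_ne_top d (hX.symm.trans moduleDepth_eq_top_of_subsingleton)
  · rintro ⟨_, h⟩
    refine ⟨inferInstance, moduleDepth_le_ringKrullDim.antisymm ?_⟩
    rw [hd]
    exact_mod_cast h

end Depth

section RegularSequence

open Pointwise RingTheory.Sequence

variable {R : Type u} [CommRing R] {A B X W : Type u} [AddCommGroup A] [Module R A]
  [AddCommGroup B] [Module R B] [AddCommGroup X] [Module R X] [AddCommGroup W] [Module R W]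

theorem isWeaklyRegular_of_retract {i : A →ₗ[R] B} {p : B →ₗ[R] A} (h : p ∘ₗ i = LinearMap.id)
    {rs : List R} (hB : IsWeaklyRegular B rs) : IsWeaklyRegular A rs := by
  induction rs generalizing A B with
  | nil => exact .nil R A
  | cons x rs ih =>
    obtain ⟨hx, hrs⟩ := (isWeaklyRegular_cons_iff B x rs).mp hB
    refine .cons (hx.of_injective i (LinearMap.injective_of_comp_eq_id i p h))
      (ih (i := QuotSMulTop.map x i) (p := QuotSMulTop.map x p) ?_ hrs)
    rw [← QuotSMulTop.map_comp, h, QuotSMulTop.map_id]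

theorem le_annihilator_quotient_smul_top (I : Ideal R) :
    I ≤ Module.annihilator R (X ⧸ I • (⊤ : Submodule R X)) := by
  intro r hr
  rw [Module.mem_annihilator]
  rintro ⟨a⟩
  exact (Submodule.Quotient.mk_eq_zero _).mpr (Submodule.smul_mem_smul hr trivial)

theorem subsingleton_ext_quotient_ofList {rs : List R} (hr : IsWeaklyRegular X rs) {c : ℕ}
    (h : ∀ i > c, Subsingleton (ExtMod R i X W)) {i : ℕ} (hi : c + rs.length < i) :
    Subsingleton (ExtMod R i (X ⧸ Ideal.ofList rs • (⊤ : Submodule R X)) W) := by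
  induction rs generalizing X c with
  | nil =>
    have e : (X ⧸ Ideal.ofList ([] : List R) • (⊤ : Submodule R X)) ≃ₗ[R] X :=
      Submodule.quotEquivOfEqBot _ (by rw [Ideal.ofList_nil, Submodule.bot_smul])
    exact (ExtMod.subsingleton_congr e).mpr (h i hi)
  | cons x rs ih =>
    obtain ⟨hx, hrs⟩ := (isWeaklyRegular_cons_iff X x rs).mp hr
    rw [ExtMod.subsingleton_congr (Submodule.quotOfListConsSMulTopEquivQuotSMulTopInner X x rs)]
    refine ih hrs (c := c + 1) (fun j hj ↦ ?_) (by grind)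
    obtain ⟨j, rfl⟩ := Nat.exists_eq_succ_of_ne_zero (Nat.ne_zero_of_lt hj)
    exact ExtMod.contravariant_subsingleton₃ (f := LinearMap.lsmul R X x) hx
      (Submodule.mkQ_surjective _) (LinearMap.exact_lsmul_mkQ_smul_top X x) (h j (by omega))
      (h (j + 1) (by omega))

theorem exists_smul_eq_of_subsingleton_ext_quotSMulTop {x : R} (hx : IsSMulRegular X x) {i : ℕ}
    (h : Subsingleton (ExtMod R (i + 1) (QuotSMulTop x X) W)) (z : ExtMod R i X W) :
    ∃ y : ExtMod R i X W, x • y = z := by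
  obtain ⟨y, hy⟩ := Abelian.Ext.contravariant_sequence_exact₁ (shortExact_lsmul_mkQ hx)
    (ModuleCat.of R W) z (add_comm 1 i) (h.elim _ _)
  refine ⟨y, hy ▸ ?_⟩
  have : x • y = (Abelian.Ext.mk₀ (x • 𝟙 (ModuleCat.of R X))).comp y (zero_add i) := by
    rw [Abelian.Ext.mk₀_smul, Abelian.Ext.smul_comp, Abelian.Ext.mk₀_id_comp]
  exact this

variable [IsLocalRing R]

theorem eq_maximalIdeal_of_radical_eq {I p : Ideal R} (hI : I.radical = maximalIdeal R)
    (hp : p.IsPrime) (h : I ≤ p) : p = maximalIdeal R :=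
  ((maximalIdeal.isMaximal R).eq_of_le hp.ne_top (hI.symm.le.trans (hp.radical_le_iff.mpr h))).symm

variable [IsNoetherianRing R]

theorem exists_isWeaklyRegular_prod [Module.Finite R A] [Module.Finite R B] [Module.Finite R X]
    {d : ℕ} (hA : GradeGE R d (ResidueField R) A) (hB : GradeGE R d (ResidueField R) B)
    (hX : GradeGE R d (ResidueField R) X) :
    ∃ rs : List R, rs.length = d ∧ (∀ r ∈ rs, r ∈ maximalIdeal R) ∧
      IsWeaklyRegular A rs ∧ IsWeaklyRegular B rs ∧ IsWeaklyRegular X rs := by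
  obtain ⟨rs, hl, hm, hr⟩ := exists_isWeaklyRegular_iff_gradeGE.mpr ((hA.prod hB).prod hX)
  have hAB : IsWeaklyRegular (A × B) rs := isWeaklyRegular_of_retract (LinearMap.fst_comp_inl ..) hr
  exact ⟨rs, hl, hm, isWeaklyRegular_of_retract (LinearMap.fst_comp_inl ..) hAB,
    isWeaklyRegular_of_retract (LinearMap.snd_comp_inr ..) hAB,
    isWeaklyRegular_of_retract (LinearMap.snd_comp_inr ..) hr⟩

theorem supportDim_quotient_ofList_eq_zero {rs : List R} (hm : ∀ r ∈ rs, r ∈ maximalIdeal R)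
    (hr : IsWeaklyRegular R rs) (hd : ringKrullDim R = rs.length) :
    Module.supportDim R (R ⧸ Ideal.ofList rs • (⊤ : Submodule R R)) = 0 := by
  have hreg := IsRegular.of_isWeaklyRegular_of_mem_maximalIdeal R hm hr
  have hsum := Module.supportDim_add_length_eq_supportDim_of_isRegular rs hreg
  rw [Module.supportDim_self_eq_ringKrullDim, hd] at hsum
  have : Nontrivial (R ⧸ Ideal.ofList rs • (⊤ : Submodule R R)) :=
    hreg.quot_ofList_smul_nontrivial _
  obtain ⟨a, ha⟩ := WithBot.ne_bot_iff_exists.mp ((Module.supportDim_ne_bot_iff_nontrivial R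
    (R ⧸ Ideal.ofList rs • (⊤ : Submodule R R))).mpr this)
  rw [← ha] at hsum ⊢
  have h0 : a + (rs.length : ℕ∞) = 0 + (rs.length : ℕ∞) := by
    rw [zero_add]
    exact_mod_cast hsum
  rw [ENat.add_left_injective_of_ne_top (ENat.natCast_ne_top rs.length) h0, WithBot.coe_zero]

theorem radical_ofList_eq_maximalIdeal {rs : List R} (hm : ∀ r ∈ rs, r ∈ maximalIdeal R)
    (hr : IsWeaklyRegular R rs) (hd : ringKrullDim R = rs.length) :
    (Ideal.ofList rs).radical = maximalIdeal R := by
  have hsupp := support_of_supportDim_eq_zero R _ (supportDim_quotient_ofList_eq_zero hm hr hd)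
  rw [Module.support_eq_zeroLocus, Ideal.smul_eq_mul, Ideal.mul_top, Ideal.annihilator_quotient,
    PrimeSpectrum.zeroLocus_eq_iff] at hsupp
  rw [hsupp, (maximalIdeal.isMaximal R).isPrime.radical]

end RegularSequence

section InjectiveDimension

open Pointwise RingTheory.Sequence

variable {R : Type u} [CommRing R] [IsLocalRing R] [IsNoetherianRing R] {X Y W : Type u}
  [AddCommGroup X] [Module R X] [AddCommGroup Y] [Module R Y] [AddCommGroup W] [Module R W]

theorem exists_injective_residueField [Nontrivial Y] {I : Ideal R}
    (hI : I.radical = maximalIdeal R) (hY : I ≤ Module.annihilator R Y) :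
    ∃ f : ResidueField R →ₗ[R] Y, Function.Injective f := by
  obtain ⟨p, hass⟩ := associatedPrimes.nonempty R Y
  obtain rfl := eq_maximalIdeal_of_radical_eq hI hass.isPrime
    (hY.trans (Submodule.annihilator_top.symm.le.trans hass.annihilator_le))
  exact (isAssociatedPrime_iff_exists_injective_linearMap _ _ |>.mp hass).2

theorem subsingleton_ext_of_quotSMulTop [Module.Finite R X] [Module.Finite R W] {x : R}
    (hx : IsSMulRegular X x) (hm : x ∈ maximalIdeal R) {i : ℕ}
    (h : Subsingleton (ExtMod R (i + 1) (QuotSMulTop x X) W)) :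
    Subsingleton (ExtMod R i X W) := by
  have hle : (⊤ : Submodule R (ExtMod R i X W)) ≤ maximalIdeal R • ⊤ := by
    intro z _
    obtain ⟨y, rfl⟩ := exists_smul_eq_of_subsingleton_ext_quotSMulTop hx h z
    exact Submodule.smul_mem_smul hm trivial
  have hbot := Submodule.eq_bot_of_le_smul_of_le_jacobson_bot (maximalIdeal R) ⊤
    Module.Finite.fg_top hle (maximalIdeal_le_jacobson _)
  exact (Submodule.subsingleton_iff R).mp (subsingleton_of_bot_eq_top hbot.symm)

theorem subsingleton_ext_of_residueField [Module.Finite R W] {i : ℕ}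
    (h : ∀ (Y : Type u) [AddCommGroup Y] [Module R Y] [Module.Finite R Y],
      Subsingleton (ExtMod R (i + 1) Y W))
    (hk : Subsingleton (ExtMod R i (ResidueField R) W)) [hY : Module.Finite R Y] :
    Subsingleton (ExtMod R i Y W) := by
  induction hY using IsNoetherianRing.induction_on_isQuotientEquivQuotientPrime R with
  | subsingleton N => exact ExtMod.subsingleton_of_subsingleton_left i
  | quotient N p e =>
    rw [ExtMod.subsingleton_congr e]
    by_cases hp : p.1 = maximalIdeal R
    · rw [hp]
      exact hk
    · obtain ⟨x, hx, hxp⟩ : ∃ x ∈ maximalIdeal R, x ∉ p.1 := by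
        by_contra! hle
        exact hp ((maximalIdeal.isMaximal R).eq_of_le p.2.ne_top hle).symm
      refine subsingleton_ext_of_quotSMulTop (x := x) (.of_right_eq_zero_of_smul ?_) hx (h _)
      rintro ⟨a⟩ ha
      have : x * a ∈ p.1 := Ideal.Quotient.eq_zero_iff_mem.mp ha
      exact Ideal.Quotient.eq_zero_iff_mem.mpr ((p.2.mem_or_mem this).resolve_left hxp)
  | exact N₁ N₂ N₃ f g hf hg hfg h₁ h₃ =>
    exact ExtMod.contravariant_subsingleton₂ hf hg hfg h₁ h₃

theorem subsingleton_ext_residueField {rs : List R} (hm : ∀ r ∈ rs, r ∈ maximalIdeal R)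
    (hr : IsWeaklyRegular R rs) (hrad : (Ideal.ofList rs).radical = maximalIdeal R) {i : ℕ}
    (hi : rs.length < i) (h : ∀ (Y : Type u) [AddCommGroup Y] [Module R Y] [Module.Finite R Y],
      Subsingleton (ExtMod R (i + 1) Y W)) : Subsingleton (ExtMod R i (ResidueField R) W) := by
  have : Nontrivial (R ⧸ Ideal.ofList rs • (⊤ : Submodule R R)) :=
    (IsRegular.of_isWeaklyRegular_of_mem_maximalIdeal R hm hr).quot_ofList_smul_nontrivial _
  obtain ⟨f, hf⟩ := exists_injective_residueField hrad
    (le_annihilator_quotient_smul_top (X := R) (Ideal.ofList rs))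
  refine ExtMod.contravariant_subsingleton₁ hf (Submodule.mkQ_surjective _) f.exact_map_mkQ_range
    (subsingleton_ext_quotient_ofList hr (c := 0) (fun j hj ↦ ?_) (by omega)) (h _)
  obtain ⟨j, rfl⟩ := Nat.exists_eq_succ_of_ne_zero hj.ne'
  exact ExtMod.subsingleton_of_projective j

theorem subsingleton_ext_of_hasInjectiveDimensionLE [Module.Finite R W] {m : ℕ}
    (hW : HasInjectiveDimensionLE (ModuleCat.of R W) m) {rs : List R}
    (hm : ∀ r ∈ rs, r ∈ maximalIdeal R) (hr : IsWeaklyRegular R rs)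
    (hrad : (Ideal.ofList rs).radical = maximalIdeal R) {i : ℕ} (hi : rs.length < i)
    [Module.Finite R Y] : Subsingleton (ExtMod R i Y W) := by
  suffices H : ∀ j i : ℕ, rs.length < i → m < i + j → ∀ (Y : Type u) [AddCommGroup Y]
      [Module R Y] [Module.Finite R Y], Subsingleton (ExtMod R i Y W) from
    H (m + 1) i hi (by omega) Y
  intro j
  induction j with
  | zero =>
    intro i _ hi Y _ _ _
    exact HasInjectiveDimensionLT.subsingleton (ModuleCat.of R W) (m + 1) i hi _
  | succ j ih =>
    intro i hi hij Y _ _ _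
    have hsucc := ih (i + 1) (by omega) (by omega)
    exact subsingleton_ext_of_residueField hsucc
      (subsingleton_ext_residueField hm hr hrad hi hsucc)

theorem subsingleton_ext_of_isWeaklyRegular [Module.Finite R W] {d : ℕ}
    (hW : ∀ i > d, ∀ (Y : Type u) [AddCommGroup Y] [Module R Y] [Module.Finite R Y],
      Subsingleton (ExtMod R i Y W))
    [Module.Finite R X] {rs : List R} (hm : ∀ r ∈ rs, r ∈ maximalIdeal R)
    (hr : IsWeaklyRegular X rs) {i : ℕ} (hi : d < i + rs.length) :
    Subsingleton (ExtMod R i X W) := by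
  induction rs generalizing X i with
  | nil => exact hW i hi X
  | cons x rs ih =>
    obtain ⟨hx, hm⟩ := List.forall_mem_cons.mp hm
    obtain ⟨hreg, hr⟩ := (isWeaklyRegular_cons_iff X x rs).mp hr
    exact subsingleton_ext_of_quotSMulTop hreg hx (ih hm hr (by grind))

end InjectiveDimension

section Acyclic

open Abelian

/-- The module `X` is acyclic for `Hom(-, W)`: the modules `Ext^i(X, W)` vanish for `i > 0`. -/
def IsExtAcyclic (R : Type u) [CommRing R] (X W : Type u) [AddCommGroup X] [Module R X]
    [AddCommGroup W] [Module R W] : Prop :=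
  ∀ i, Subsingleton (ExtMod R (i + 1) X W)

variable {R : Type u} [CommRing R] {A B C P X W : Type u} [AddCommGroup A] [Module R A]
  [AddCommGroup B] [Module R B] [AddCommGroup C] [Module R C] [AddCommGroup P] [Module R P]
  [AddCommGroup X] [Module R X] [AddCommGroup W] [Module R W]

theorem exists_injective_subsingleton_ext (R : Type u) [CommRing R] (W : Type u) [AddCommGroup W]
    [Module R W] : ∃ (J : Type u) (_ : AddCommGroup J) (_ : Module R J) (f : W →ₗ[R] J),
      Function.Injective f ∧ ∀ (L : Type u) [AddCommGroup L] [Module R L], IsExtAcyclic R L J :=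
  ⟨(Injective.under (ModuleCat.of R W) : ModuleCat.{u} R), inferInstance, inferInstance,
    (Injective.ι (ModuleCat.of R W)).hom, (ModuleCat.mono_iff_injective _).mp inferInstance,
    fun L _ _ i ↦ Ext.subsingleton_of_injective (ModuleCat.of R L)
      (Injective.under (ModuleCat.of R W)) i⟩

theorem ExtMod.subsingleton_one_of_exists_lift {f : A →ₗ[R] B} {g : B →ₗ[R] C}
    (hf : Function.Injective f) (hg : Function.Surjective g) (h : Function.Exact f g)
    (hB : Subsingleton (ExtMod R 1 X B)) (hlift : ∀ φ : X →ₗ[R] C, ∃ ψ : X →ₗ[R] B, g ∘ₗ ψ = φ) :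
    Subsingleton (ExtMod R 1 X A) := by
  refine subsingleton_of_forall_eq 0 fun x ↦ ?_
  obtain ⟨y, rfl⟩ := Ext.covariant_sequence_exact₁ _ (shortExact_of_exact hf hg h) x
    (hB.elim _ _) (zero_add 1)
  obtain ⟨φ, rfl⟩ := (Ext.mk₀_bijective _ _).2 y
  obtain ⟨ψ, hψ⟩ := hlift φ.hom
  have : φ = ModuleCat.ofHom ψ ≫
      (ModuleCat.shortComplexOfCompEqZero f g h.linearMap_comp_eq_zero).g := by
    ext a
    exact LinearMap.congr_fun hψ.symm a
  rw [this, ← Ext.mk₀_comp_mk₀, Ext.comp_assoc_of_second_deg_zero,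
    ShortComplex.ShortExact.comp_extClass, Ext.comp_zero]

theorem subsingleton_ext_one_tensor [Module.Projective R P] (h : Subsingleton (ExtMod R 1 X W)) :
    Subsingleton (ExtMod R 1 (P ⊗[R] X) W) := by
  obtain ⟨J, _, _, f, hf, hJ⟩ := exists_injective_subsingleton_ext R W
  refine ExtMod.subsingleton_one_of_exists_lift hf (Submodule.mkQ_surjective _)
    f.exact_map_mkQ_range (hJ _ 0) fun φ ↦ ?_
  have hs : Function.Surjective (LinearMap.compRight R (M := X) (LinearMap.range f).mkQ) := fun φ ↦
    ExtMod.exists_lift hf (Submodule.mkQ_surjective _) f.exact_map_mkQ_range h φ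
  obtain ⟨ψ, hψ⟩ := Module.projective_lifting_property _ (TensorProduct.curry φ) hs
  refine ⟨TensorProduct.lift ψ, TensorProduct.ext' fun p x ↦ ?_⟩
  exact LinearMap.congr_fun (LinearMap.congr_fun hψ p) x

namespace IsExtAcyclic

theorem congr (e : A ≃ₗ[R] B) (h : IsExtAcyclic R A W) : IsExtAcyclic R B W :=
  fun i ↦ (ExtMod.subsingleton_congr e).mp (h i)

theorem of_subsingleton [Subsingleton A] : IsExtAcyclic R A W :=
  fun i ↦ ExtMod.subsingleton_of_subsingleton_left (i + 1)

theorem middle {f : A →ₗ[R] B} {g : B →ₗ[R] C} (hf : Function.Injective f)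
    (hg : Function.Surjective g) (h : Function.Exact f g) (hA : IsExtAcyclic R A W)
    (hC : IsExtAcyclic R C W) : IsExtAcyclic R B W :=
  fun i ↦ ExtMod.contravariant_subsingleton₂ hf hg h (hA i) (hC i)

theorem left {f : A →ₗ[R] B} {g : B →ₗ[R] C} (hf : Function.Injective f)
    (hg : Function.Surjective g) (h : Function.Exact f g) (hB : IsExtAcyclic R B W)
    (hC : IsExtAcyclic R C W) : IsExtAcyclic R A W :=
  fun i ↦ ExtMod.contravariant_subsingleton₁ hf hg h (hB i) (hC (i + 1))

theorem tensor [Module.Projective R P] (h : IsExtAcyclic R X W) :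
    IsExtAcyclic R (P ⊗[R] X) W := by
  intro i
  induction i generalizing W with
  | zero => exact subsingleton_ext_one_tensor (h 0)
  | succ i ih =>
    obtain ⟨J, _, _, f, hf, hJ⟩ := exists_injective_subsingleton_ext R W
    refine ExtMod.covariant_subsingleton₁ hf (Submodule.mkQ_surjective _) f.exact_map_mkQ_range
      (ih fun j ↦ ?_) (hJ _ _)
    exact ExtMod.covariant_subsingleton₃ hf (Submodule.mkQ_surjective _) f.exact_map_mkQ_range
      (hJ X j) (h (j + 1))

end IsExtAcyclic

end Acyclic

section HomReduction

open Pointwise RingTheory.Sequence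

variable {R : Type u} [CommRing R] {X W : Type u} [AddCommGroup X] [Module R X]
  [AddCommGroup W] [Module R W]

theorem isSMulRegular_linearMap {x : R} (hx : IsSMulRegular W x) : IsSMulRegular (X →ₗ[R] W) x :=
  fun _ _ h ↦ LinearMap.ext fun a ↦ hx (LinearMap.congr_fun h a)

theorem ker_compRight_mkQ_eq_smul_top {x : R} (hx : IsSMulRegular W x) :
    LinearMap.ker (LinearMap.compRight R (M := X) (x • (⊤ : Submodule R W)).mkQ) =
      x • (⊤ : Submodule R (X →ₗ[R] W)) := by
  ext f
  constructor
  · intro hf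
    have hmem (a : X) : ∃ b : W, x • b = f a :=
      (LinearMap.exact_lsmul_mkQ_smul_top W x (f a)).mp (LinearMap.congr_fun hf a)
    choose g hg using hmem
    exact ⟨⟨⟨g, fun a b ↦ hx (by simp [smul_add, hg])⟩,
      fun r a ↦ hx (by simp [smul_comm x r, hg])⟩, trivial, LinearMap.ext hg⟩
  · rintro ⟨g, -, rfl⟩
    exact LinearMap.ext fun a ↦ (Submodule.Quotient.mk_eq_zero _).mpr ⟨g a, trivial, rfl⟩

theorem compRight_mkQ_surjective {x : R} (hx : IsSMulRegular W x)
    (h : Subsingleton (ExtMod R 1 X W)) :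
    Function.Surjective
      (LinearMap.compRight R (M := X) (x • (⊤ : Submodule R W)).mkQ) := fun φ ↦
  ExtMod.exists_lift (f := LinearMap.lsmul R W x) hx (Submodule.mkQ_surjective _)
    (LinearMap.exact_lsmul_mkQ_smul_top W x) h φ

namespace IsExtAcyclic

theorem quotSMulTop {x : R} (hx : IsSMulRegular W x) (h : IsExtAcyclic R X W) :
    IsExtAcyclic R X (QuotSMulTop x W) := fun i ↦
  ExtMod.covariant_subsingleton₃ (f := LinearMap.lsmul R W x) hx (Submodule.mkQ_surjective _)
    (LinearMap.exact_lsmul_mkQ_smul_top W x) (h i) (h (i + 1))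

theorem isWeaklyRegular_linearMap {rs : List R} (hr : IsWeaklyRegular W rs)
    (h : IsExtAcyclic R X W) : IsWeaklyRegular (X →ₗ[R] W) rs := by
  induction rs generalizing W with
  | nil => exact .nil R _
  | cons x rs ih =>
    obtain ⟨hx, hrs⟩ := (isWeaklyRegular_cons_iff W x rs).mp hr
    let e : QuotSMulTop x (X →ₗ[R] W) ≃ₗ[R] (X →ₗ[R] QuotSMulTop x W) :=
      (Submodule.quotEquivOfEq _ _ (ker_compRight_mkQ_eq_smul_top hx).symm).trans
        (LinearMap.quotKerEquivOfSurjective _ (compRight_mkQ_surjective hx (h 0)))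
    exact .cons (isSMulRegular_linearMap hx)
      ((e.isWeaklyRegular_congr rs).mpr (ih hrs (h.quotSMulTop hx)))

theorem exists_lift_mkQ {rs : List R} (hr : IsWeaklyRegular W rs) (h : IsExtAcyclic R X W)
    (ψ : X →ₗ[R] W ⧸ Ideal.ofList rs • (⊤ : Submodule R W)) :
    ∃ φ : X →ₗ[R] W, (Ideal.ofList rs • (⊤ : Submodule R W)).mkQ ∘ₗ φ = ψ := by
  induction rs generalizing W with
  | nil =>
    let e : (W ⧸ Ideal.ofList ([] : List R) • (⊤ : Submodule R W)) ≃ₗ[R] W :=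
      Submodule.quotEquivOfEqBot _ (by rw [Ideal.ofList_nil, Submodule.bot_smul])
    exact ⟨e ∘ₗ ψ, LinearMap.ext fun a ↦ e.symm_apply_apply (ψ a)⟩
  | cons x rs ih =>
    obtain ⟨hx, hrs⟩ := (isWeaklyRegular_cons_iff W x rs).mp hr
    let e := Submodule.quotOfListConsSMulTopEquivQuotSMulTopInner W x rs
    obtain ⟨φ', hφ'⟩ := ih hrs (h.quotSMulTop hx) (e ∘ₗ ψ)
    obtain ⟨φ, rfl⟩ := compRight_mkQ_surjective hx (h 0) φ'
    exact ⟨φ, LinearMap.ext fun a ↦ e.injective (LinearMap.congr_fun hφ' a)⟩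

theorem mem_ofList_smul_top {rs : List R} (hr : IsWeaklyRegular W rs) (h : IsExtAcyclic R X W)
    {φ : X →ₗ[R] W} (hφ : ∀ a, φ a ∈ Ideal.ofList rs • (⊤ : Submodule R W)) :
    φ ∈ Ideal.ofList rs • (⊤ : Submodule R (X →ₗ[R] W)) := by
  induction rs generalizing W with
  | nil =>
    rw [Ideal.ofList_nil, Submodule.bot_smul] at hφ ⊢
    exact (Submodule.mem_bot R).mpr (LinearMap.ext fun a ↦ (Submodule.mem_bot R).mp (hφ a))
  | cons x rs ih =>
    obtain ⟨hx, hrs⟩ := (isWeaklyRegular_cons_iff W x rs).mp hr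
    let p : (X →ₗ[R] W) →ₗ[R] X →ₗ[R] QuotSMulTop x W :=
      LinearMap.compRight R (x • (⊤ : Submodule R W)).mkQ
    have hp : p φ ∈ Ideal.ofList rs • (⊤ : Submodule R (X →ₗ[R] QuotSMulTop x W)) := by
      refine ih hrs (h.quotSMulTop hx) fun a ↦ ?_
      rw [← Submodule.Quotient.mk_eq_zero]
      exact (Submodule.quotOfListConsSMulTopEquivQuotSMulTopInner W x rs).map_eq_zero_iff.mpr
        ((Submodule.Quotient.mk_eq_zero _).mpr (hφ a))
    rw [← LinearMap.range_eq_top.mpr (compRight_mkQ_surjective hx (h 0)), ← Submodule.map_top,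
      ← Submodule.map_smul''] at hp
    obtain ⟨χ, hχ, hχφ⟩ := hp
    have hker : φ - χ ∈ x • (⊤ : Submodule R (X →ₗ[R] W)) := by
      rw [← ker_compRight_mkQ_eq_smul_top hx, LinearMap.mem_ker, map_sub]
      exact sub_eq_zero.mpr hχφ.symm
    rw [Ideal.ofList_cons_smul, ← sub_add_cancel φ χ]
    exact Submodule.add_mem_sup hker hχ

end IsExtAcyclic

end HomReduction

section Dualizing

open Abelian Pointwise RingTheory.Sequence

variable {R : Type u} [CommRing R] {L E W : Type u} [AddCommGroup L] [Module R L]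
  [AddCommGroup E] [Module R E] [AddCommGroup W] [Module R W]

theorem exists_ext_comp_bijective_of_isWeaklyRegular {rs : List R} (hr : IsWeaklyRegular W rs) :
    ∃ ε : ExtMod R rs.length (W ⧸ Ideal.ofList rs • (⊤ : Submodule R W)) W,
      ∀ (L : Type u) [AddCommGroup L] [Module R L], (∀ r ∈ rs, r ∈ Module.annihilator R L) →
        Function.Bijective fun φ : L →ₗ[R] W ⧸ Ideal.ofList rs • (⊤ : Submodule R W) ↦
          ((Ext.mk₀ (ModuleCat.ofHom φ)).comp ε (zero_add _) : ExtMod R rs.length L W) := by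
  induction rs generalizing W with
  | nil =>
    let e : (W ⧸ Ideal.ofList ([] : List R) • (⊤ : Submodule R W)) ≃ₗ[R] W :=
      Submodule.quotEquivOfEqBot _ (by rw [Ideal.ofList_nil, Submodule.bot_smul])
    refine ⟨Ext.mk₀ (ModuleCat.ofHom e.toLinearMap), fun L _ _ _ ↦ ?_⟩
    simp only [Ext.mk₀_comp_mk₀, ← ModuleCat.ofHom_comp]
    exact (ExtMod.zeroEquiv (R := R)).symm.bijective.comp (e.congrRight (M := L)).bijective
  | cons x rs ih =>
    obtain ⟨hx, hrs⟩ := (isWeaklyRegular_cons_iff W x rs).mp hr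
    obtain ⟨ε, hε⟩ := ih hrs
    let e := Submodule.quotOfListConsSMulTopEquivQuotSMulTopInner W x rs
    refine ⟨(Ext.mk₀ (ModuleCat.ofHom e.toLinearMap)).comp
      (ε.comp (shortExact_lsmul_mkQ hx).extClass rfl) (zero_add _), fun L _ _ hL ↦ ?_⟩
    have hδ := comp_extClass_lsmul_mkQ_bijective hx (hL x List.mem_cons_self)
      (GradeGE.of_isWeaklyRegular hL hr _ (Nat.lt_succ_self rs.length))
    refine (congr_arg Function.Bijective (funext fun φ ↦ ?_)).mpr (hδ.comp
      ((hε L fun r h ↦ hL r (List.mem_cons_of_mem x h)).comp (e.congrRight (M := L)).bijective))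
    refine (Ext.mk₀_comp_mk₀_assoc (ModuleCat.ofHom φ) (ModuleCat.ofHom e.toLinearMap) _).trans ?_
    exact (Ext.comp_assoc _ _ _ (zero_add _) _ (by rw [zero_add, List.length_cons])).symm

/-- On finite modules killed by `I`, the functor `Hom(-, E)` turns monomorphisms into surjections,
and it fixes the residue field. If `I` is primary to the maximal ideal, such an `E` plays the role
of an injective hull of the residue field over `R ⧸ I`. -/
structure IsDualizingModulo [IsLocalRing R] (I : Ideal R) (E : Type u) [AddCommGroup E]
    [Module R E] : Prop where
  exists_extension : ∀ (L' L : Type u) [AddCommGroup L'] [Module R L'] [AddCommGroup L]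
    [Module R L] [Module.Finite R L], I ≤ Module.annihilator R L →
    ∀ f : L' →ₗ[R] L, Function.Injective f → ∀ φ : L' →ₗ[R] E, ∃ ψ : L →ₗ[R] E, ψ ∘ₗ f = φ
  residueField : Nonempty ((ResidueField R →ₗ[R] E) ≃ₗ[R] ResidueField R)

theorem isDualizingModulo_quotient_smul_top [IsLocalRing R] {rs : List R}
    (hm : ∀ r ∈ rs, r ∈ maximalIdeal R) (hr : IsWeaklyRegular W rs)
    (hW : ∀ (L : Type u) [AddCommGroup L] [Module R L] [Module.Finite R L],
      Subsingleton (ExtMod R (rs.length + 1) L W))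
    (hk : Nonempty (ExtMod R rs.length (ResidueField R) W ≃ₗ[R] ResidueField R)) :
    IsDualizingModulo (Ideal.ofList rs) (W ⧸ Ideal.ofList rs • (⊤ : Submodule R W)) := by
  obtain ⟨ε, hε⟩ := exists_ext_comp_bijective_of_isWeaklyRegular hr
  constructor
  · intro L' L _ _ _ _ _ hL f hf φ
    replace hL (r : R) (h : r ∈ rs) := hL (Ideal.subset_span h)
    have hS := shortExact_of_exact hf (Submodule.mkQ_surjective _) f.exact_map_mkQ_range
    obtain ⟨z, hz⟩ := Ext.contravariant_sequence_exact₁ hS (ModuleCat.of R W)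
      ((Ext.mk₀ (ModuleCat.ofHom φ)).comp ε (zero_add _)) (add_comm 1 _)
      ((hW (L ⧸ LinearMap.range f)).elim _ _)
    obtain ⟨ψ, rfl⟩ := (hε L hL).2 z
    refine ⟨ψ, (hε L' fun r h ↦ f.annihilator_le_of_injective hf (hL r h)).1 ?_⟩
    exact (Ext.mk₀_comp_mk₀_assoc (ModuleCat.ofHom f) (ModuleCat.ofHom ψ) ε).symm.trans hz
  · obtain ⟨σ⟩ := hk
    refine ⟨(LinearEquiv.ofBijective (Ext.postcompOfLinear ε R (ModuleCat.of R (ResidueField R))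
      (zero_add _) ∘ₗ ExtMod.zeroEquiv.symm.toLinearMap) ?_).trans σ⟩
    exact hε (ResidueField R) (by rwa [annihilator_residueField])

namespace IsDualizingModulo

variable [IsLocalRing R] {I : Ideal R}

theorem applyₗ_bijective_residueField (hE : IsDualizingModulo I E) (e : L ≃ₗ[R] ResidueField R) :
    Function.Bijective (LinearMap.applyₗ : L →ₗ[R] (L →ₗ[R] E) →ₗ[R] E) := by
  obtain ⟨σ⟩ := hE.residueField
  let τ : (L →ₗ[R] E) ≃ₗ[R] ResidueField R := (e.congrLeft E R).trans σ
  let τ' : ((L →ₗ[R] E) →ₗ[R] E) ≃ₗ[R] ResidueField R := (τ.congrLeft E R).trans σ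
  have : IsSimpleModule R (ResidueField R) :=
    isSimpleModule_iff_quot_maximal.mpr ⟨_, maximalIdeal.isMaximal R, ⟨.refl R _⟩⟩
  have : IsSimpleModule R L := .congr e
  have : IsSimpleModule R ((L →ₗ[R] E) →ₗ[R] E) := .congr τ'
  refine (LinearMap.bijective_or_eq_zero _).resolve_right fun h0 ↦ ?_
  have : Nontrivial (L →ₗ[R] E) := τ.toEquiv.nontrivial
  obtain ⟨f, hf⟩ := exists_ne (0 : L →ₗ[R] E)
  exact hf (LinearMap.ext fun a ↦ LinearMap.congr_fun (LinearMap.congr_fun h0 a) f)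

end IsDualizingModulo

section Bidual

variable {A B C : Type u} [AddCommGroup A] [Module R A] [AddCommGroup B] [Module R B]
  [AddCommGroup C] [Module R C] {f : A →ₗ[R] B} {g : B →ₗ[R] C}

theorem applyₗ_injective_of_exact (h : Function.Exact f g)
    (hf : ∀ φ : A →ₗ[R] E, ∃ ψ : B →ₗ[R] E, ψ ∘ₗ f = φ)
    (hA : Function.Injective (LinearMap.applyₗ : A →ₗ[R] (A →ₗ[R] E) →ₗ[R] E))
    (hC : Function.Injective (LinearMap.applyₗ : C →ₗ[R] (C →ₗ[R] E) →ₗ[R] E)) :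
    Function.Injective (LinearMap.applyₗ : B →ₗ[R] (B →ₗ[R] E) →ₗ[R] E) := by
  refine (injective_iff_map_eq_zero _).mpr fun b hb ↦ ?_
  have hgb : g b = 0 := (injective_iff_map_eq_zero _).mp hC _
    (LinearMap.ext fun φ ↦ LinearMap.congr_fun hb (φ ∘ₗ g))
  obtain ⟨a, rfl⟩ := (h b).mp hgb
  have ha : a = 0 := (injective_iff_map_eq_zero _).mp hA _ <| LinearMap.ext fun φ ↦ by
    obtain ⟨ψ, rfl⟩ := hf φ
    exact LinearMap.congr_fun hb ψ
  rw [ha, map_zero]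

theorem applyₗ_surjective_of_exact (hg : Function.Surjective g) (h : Function.Exact f g)
    (hf : Function.Surjective (f.lcomp R E))
    (hA : Function.Surjective (LinearMap.applyₗ : A →ₗ[R] (A →ₗ[R] E) →ₗ[R] E))
    (hC : Function.Surjective (LinearMap.applyₗ : C →ₗ[R] (C →ₗ[R] E) →ₗ[R] E)) :
    Function.Surjective (LinearMap.applyₗ : B →ₗ[R] (B →ₗ[R] E) →ₗ[R] E) := by
  intro Λ
  obtain ⟨c, hc⟩ := hC (Λ ∘ₗ g.lcomp R E)
  obtain ⟨b, rfl⟩ := hg c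
  have hexact : Function.Exact ((f.lcomp R E).lcomp R E) ((g.lcomp R E).lcomp R E) :=
    LinearMap.exact_lcomp_of_exact_of_surjective E
      (LinearMap.exact_lcomp_of_exact_of_surjective E h hg) hf
  obtain ⟨Λ', hΛ'⟩ := (hexact (Λ - LinearMap.applyₗ b)).mp (sub_eq_zero.mpr hc.symm)
  obtain ⟨a, rfl⟩ := hA Λ'
  refine ⟨b + f a, ?_⟩
  rw [map_add, ← eq_sub_iff_add_eq', ← hΛ']
  rfl

end Bidual

theorem IsDualizingModulo.applyₗ_bijective [IsLocalRing R] [IsNoetherianRing R] {I : Ideal R}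
    (hI : I.radical = maximalIdeal R) (hE : IsDualizingModulo I E) [hfin : Module.Finite R L]
    (hL : I ≤ Module.annihilator R L) :
    Function.Bijective (LinearMap.applyₗ : L →ₗ[R] (L →ₗ[R] E) →ₗ[R] E) := by
  revert hL
  induction hfin using IsNoetherianRing.induction_on_isQuotientEquivQuotientPrime R with
  | subsingleton L =>
    intro _
    have : Subsingleton (L →ₗ[R] E) := inferInstance
    exact ⟨Function.injective_of_subsingleton _, fun Λ ↦ ⟨0, Subsingleton.elim _ _⟩⟩
  | quotient L p e =>
    intro hL
    have hp : p.1 = maximalIdeal R := by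
      refine eq_maximalIdeal_of_radical_eq hI p.2 (hL.trans ?_)
      rw [e.annihilator_eq, Ideal.annihilator_quotient]
    exact hE.applyₗ_bijective_residueField (e.trans (Submodule.quotEquivOfEq _ _ hp))
  | exact A B C f g hf hg h hA hC =>
    intro hB
    obtain ⟨hAi, hAs⟩ := hA (hB.trans (f.annihilator_le_of_injective hf))
    obtain ⟨hCi, hCs⟩ := hC (hB.trans (g.annihilator_le_of_surjective hg))
    have hext := hE.exists_extension A B hB f hf
    exact ⟨applyₗ_injective_of_exact h hext hAi hCi,
      applyₗ_surjective_of_exact hg h hext hAs hCs⟩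

end Dualizing

section Biduality

open Pointwise RingTheory.Sequence

variable {R : Type u} [CommRing R] {A B N W X : Type u} [AddCommGroup A] [Module R A]
  [AddCommGroup B] [Module R B] [AddCommGroup N] [Module R N] [AddCommGroup W] [Module R W]
  [AddCommGroup X] [Module R X]

theorem bijective_of_mapQ_bijective [IsLocalRing R] [IsNoetherianRing R] [Module.Finite R A]
    [Module.Finite R B] {rs : List R} (hm : ∀ r ∈ rs, r ∈ maximalIdeal R)
    (hr : IsWeaklyRegular B rs) {f : A →ₗ[R] B}
    (h : Function.Bijective ((Ideal.ofList rs • (⊤ : Submodule R A)).mapQ _ f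
      (Submodule.smul_top_le_comap_smul_top (Ideal.ofList rs) f))) :
    Function.Bijective f := by
  have hI : Ideal.ofList rs ≤ (⊥ : Ideal R).jacobson :=
    (Ideal.span_le.mpr hm).trans (maximalIdeal_le_jacobson _)
  have hf : Function.Surjective f := by
    rw [← LinearMap.range_eq_top, ← top_le_iff]
    refine Submodule.le_of_le_smul_of_le_jacobson_bot Module.Finite.fg_top hI fun b _ ↦ ?_
    obtain ⟨a, ha⟩ := h.2 (Submodule.Quotient.mk b)
    obtain ⟨a, rfl⟩ := Submodule.Quotient.mk_surjective _ a
    rw [← sub_add_cancel b (f a), add_comm]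
    exact Submodule.add_mem_sup ⟨a, rfl⟩ ((Submodule.Quotient.eq _).mp ha.symm)
  refine ⟨LinearMap.ker_eq_bot.mp ?_, hf⟩
  have hexact : Function.Exact (0 : PUnit.{u + 1} →ₗ[R] LinearMap.ker f)
      (LinearMap.ker f).subtype :=
    (LinearMap.exact_zero_iff_injective _ _).mpr Subtype.val_injective
  refine (Submodule.subsingleton_iff_eq_bot.mp <| (Submodule.subsingleton_iff R).mp <|
    subsingleton_iff_bot_eq_top.mp (Submodule.eq_bot_of_le_smul_of_le_jacobson_bot _ ⊤
      Module.Finite.fg_top (fun k _ ↦ ?_) hI).symm)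
  have hk : Submodule.Quotient.mk (k : A) = (0 : A ⧸ Ideal.ofList rs • (⊤ : Submodule R A)) := by
    refine (injective_iff_map_eq_zero _).mp h.1 _ ?_
    rw [Submodule.mapQ_apply, LinearMap.mem_ker.mp k.2, Submodule.Quotient.mk_zero]
  obtain ⟨y, hy⟩ := (map_first_exact_on_four_term_right_exact_of_isSMulRegular_last hexact
    (LinearMap.exact_subtype_ker_map f) hf hr (Submodule.Quotient.mk k)).mp hk
  obtain ⟨y, rfl⟩ := Submodule.Quotient.mk_surjective _ y
  exact (Submodule.Quotient.mk_eq_zero _).mp hy.symm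

/-- Reduction modulo `I` of linear maps. -/
def reduceHom (I : Ideal R) (X W : Type u) [AddCommGroup X] [Module R X] [AddCommGroup W]
    [Module R W] : (X →ₗ[R] W) →ₗ[R]
      (X ⧸ I • (⊤ : Submodule R X)) →ₗ[R] W ⧸ I • (⊤ : Submodule R W) where
  toFun φ := Submodule.mapQ _ _ φ (Submodule.smul_top_le_comap_smul_top I φ)
  map_add' _ _ := Submodule.linearMap_qext _ rfl
  map_smul' _ _ := Submodule.linearMap_qext _ rfl

theorem IsExtAcyclic.reduceHom_surjective {rs : List R} (hr : IsWeaklyRegular W rs)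
    (h : IsExtAcyclic R X W) : Function.Surjective (reduceHom (Ideal.ofList rs) X W) := fun ψ ↦ by
  obtain ⟨φ, hφ⟩ := h.exists_lift_mkQ hr (ψ ∘ₗ (Ideal.ofList rs • (⊤ : Submodule R X)).mkQ)
  exact ⟨φ, Submodule.linearMap_qext _ hφ⟩

theorem IsExtAcyclic.ker_reduceHom {rs : List R} (hr : IsWeaklyRegular W rs)
    (h : IsExtAcyclic R X W) :
    LinearMap.ker (reduceHom (Ideal.ofList rs) X W) = Ideal.ofList rs • ⊤ := by
  refine le_antisymm (fun φ hφ ↦ h.mem_ofList_smul_top hr fun a ↦ ?_) ?_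
  · exact (Submodule.Quotient.mk_eq_zero _).mp
      (LinearMap.congr_fun hφ (Submodule.Quotient.mk a))
  · refine Submodule.smul_le.mpr fun r hr φ _ ↦ ?_
    rw [LinearMap.mem_ker, map_smul]
    ext a
    exact (Submodule.Quotient.mk_eq_zero _).mpr (Submodule.smul_mem_smul hr trivial)

theorem mapQ_applyₗ_bijective {rs : List R} (hr : IsWeaklyRegular W rs)
    (hN : IsExtAcyclic R N W) (hD : IsExtAcyclic R (N →ₗ[R] W) W)
    (h : Function.Bijective (LinearMap.applyₗ : (N ⧸ Ideal.ofList rs • (⊤ : Submodule R N)) →ₗ[R]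
      (_ →ₗ[R] W ⧸ Ideal.ofList rs • (⊤ : Submodule R W)) →ₗ[R] _)) :
    Function.Bijective ((Ideal.ofList rs • (⊤ : Submodule R N)).mapQ _
      (LinearMap.applyₗ : N →ₗ[R] (N →ₗ[R] W) →ₗ[R] W)
      (Submodule.smul_top_le_comap_smul_top (Ideal.ofList rs) _)) := by
  set I := Ideal.ofList rs
  have hmem (Λ : (N →ₗ[R] W) →ₗ[R] W) : Λ ∈ I • (⊤ : Submodule R ((N →ₗ[R] W) →ₗ[R] W)) ↔
      ∀ φ, Λ φ ∈ I • (⊤ : Submodule R W) := by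
    refine ⟨fun hΛ φ ↦ ?_, hD.mem_ofList_smul_top hr⟩
    rw [← hD.ker_reduceHom hr] at hΛ
    exact (Submodule.Quotient.mk_eq_zero _).mp
      (LinearMap.congr_fun hΛ (Submodule.Quotient.mk φ))
  constructor
  · refine (injective_iff_map_eq_zero _).mpr fun a ha ↦ ?_
    obtain ⟨a, rfl⟩ := Submodule.Quotient.mk_surjective _ a
    refine (injective_iff_map_eq_zero _).mp h.1 _ (LinearMap.ext fun ψ ↦ ?_)
    obtain ⟨φ, rfl⟩ := hN.reduceHom_surjective hr ψ
    exact (Submodule.Quotient.mk_eq_zero _).mpr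
      ((hmem _).mp ((Submodule.Quotient.mk_eq_zero _).mp ha) φ)
  · intro Λ
    obtain ⟨Λ, rfl⟩ := Submodule.Quotient.mk_surjective _ Λ
    have hker : (I • (⊤ : Submodule R W)).mkQ ∘ₗ Λ ∘ₗ (LinearMap.ker (reduceHom I N W)).subtype =
        0 := by
      ext ⟨φ, hφ⟩
      rw [hN.ker_reduceHom hr] at hφ
      exact (Submodule.Quotient.mk_eq_zero _).mpr
        (Submodule.smul_top_le_comap_smul_top I Λ hφ)
    obtain ⟨Λ', hΛ'⟩ := (LinearMap.exact_lcomp_of_exact_of_surjective _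
      (LinearMap.exact_subtype_ker_map (reduceHom I N W)) (hN.reduceHom_surjective hr)
      ((I • (⊤ : Submodule R W)).mkQ ∘ₗ Λ)).mp hker
    obtain ⟨a, rfl⟩ := h.2 Λ'
    obtain ⟨a, rfl⟩ := Submodule.Quotient.mk_surjective _ a
    refine ⟨Submodule.Quotient.mk a, (Submodule.Quotient.eq _).mpr ((hmem _).mpr fun φ ↦ ?_)⟩
    exact (Submodule.Quotient.eq _).mp (LinearMap.congr_fun hΛ' φ)

theorem applyₗ_bijective_of_isExtAcyclic [IsLocalRing R] [IsNoetherianRing R] [Module.Finite R N]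
    [Module.Finite R W] {rs : List R} (hm : ∀ r ∈ rs, r ∈ maximalIdeal R)
    (hrad : (Ideal.ofList rs).radical = maximalIdeal R) (hr : IsWeaklyRegular W rs)
    (hE : IsDualizingModulo (Ideal.ofList rs) (W ⧸ Ideal.ofList rs • (⊤ : Submodule R W)))
    (hN : IsExtAcyclic R N W) (hD : IsExtAcyclic R (N →ₗ[R] W) W) :
    Function.Bijective (LinearMap.applyₗ : N →ₗ[R] (N →ₗ[R] W) →ₗ[R] W) :=
  bijective_of_mapQ_bijective hm (hD.isWeaklyRegular_linearMap hr)
    (mapQ_applyₗ_bijective hr hN hD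
      (hE.applyₗ_bijective hrad (le_annihilator_quotient_smul_top _)))

end Biduality

section CanonicalModule

open RingTheory.Sequence

variable {R : Type u} [CommRing R] [IsLocalRing R] {X ω : Type u} [AddCommGroup X] [Module R X]
  [AddCommGroup ω] [Module R ω] [Module.Finite R X]

namespace IsCanonicalModule

variable (hR : IsCMLocalRing R) (hω : IsCanonicalModule R ω) {d : ℕ} (hd : ringKrullDim R = d)

include hR hω hd

theorem exists_isWeaklyRegular (hX : GradeGE R d (ResidueField R) X) :
    ∃ rs : List R, rs.length = d ∧ (∀ r ∈ rs, r ∈ maximalIdeal R) ∧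
      (Ideal.ofList rs).radical = maximalIdeal R ∧
      IsWeaklyRegular R rs ∧ IsWeaklyRegular ω rs ∧ IsWeaklyRegular X rs := by
  have := hR.noetherian
  have := hω.isMCM.finite
  obtain ⟨rs, rfl, hm, hrR, hrω, hrX⟩ := exists_isWeaklyRegular_prod
    ((isMCM_iff hd).mp ⟨inferInstance, hR.depth_eq⟩).2 ((isMCM_iff hd).mp hω.isMCM).2 hX
  exact ⟨rs, rfl, hm, radical_ofList_eq_maximalIdeal hm hrR hd, hrR, hrω, hrX⟩

theorem subsingleton_ext {i : ℕ} (hi : d < i) : Subsingleton (ExtMod R i X ω) := by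
  have := hR.noetherian
  have := hω.isMCM.finite
  obtain ⟨m, hm⟩ := hω.finite_injectiveDimension
  obtain ⟨rs, rfl, hmem, hrad, hrR, -, -⟩ :=
    hω.exists_isWeaklyRegular hR hd ((isMCM_iff hd).mp hω.isMCM).2
  exact subsingleton_ext_of_hasInjectiveDimensionLE hm hmem hrR hrad hi

theorem isExtAcyclic (hX : GradeGE R d (ResidueField R) X) : IsExtAcyclic R X ω := by
  have := hR.noetherian
  have := hω.isMCM.finite
  obtain ⟨rs, rfl, hmem, -, -, -, hrX⟩ := hω.exists_isWeaklyRegular hR hd hX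
  exact fun i ↦ subsingleton_ext_of_isWeaklyRegular
    (fun i hi Y _ _ _ ↦ hω.subsingleton_ext hR hd hi)
    hmem hrX (by omega)

theorem gradeGE_dual (hX : GradeGE R d (ResidueField R) X) :
    GradeGE R d (ResidueField R) (X →ₗ[R] ω) := by
  have := hR.noetherian
  have := hω.isMCM.finite
  obtain ⟨rs, rfl, hm, -, -, hrω, -⟩ := hω.exists_isWeaklyRegular hR hd hX
  exact .of_isWeaklyRegular (by rwa [annihilator_residueField])
    ((hω.isExtAcyclic hR hd hX).isWeaklyRegular_linearMap hrω)

theorem applyₗ_bijective (hX : GradeGE R d (ResidueField R) X) :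
    Function.Bijective (LinearMap.applyₗ : X →ₗ[R] (X →ₗ[R] ω) →ₗ[R] ω) := by
  have := hR.noetherian
  have := hω.isMCM.finite
  obtain ⟨rs, rfl, hm, hrad, -, hrω, -⟩ := hω.exists_isWeaklyRegular hR hd hX
  have htype : Nonempty (ExtMod R rs.length (ResidueField R) ω ≃ₗ[R] ResidueField R) := by
    obtain ⟨d, hd', h⟩ := hω.type_eq_one
    obtain rfl : rs.length = d := by exact_mod_cast hd.symm.trans hd'
    exact h
  exact applyₗ_bijective_of_isExtAcyclic hm hrad hrω
    (isDualizingModulo_quotient_smul_top hm hrω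
      (fun L _ _ _ ↦ hω.subsingleton_ext hR hd (Nat.lt_succ_self _)) htype)
    (hω.isExtAcyclic hR hd hX) (hω.isExtAcyclic hR hd (hω.gradeGE_dual hR hd hX))

end IsCanonicalModule

end CanonicalModule

section Syzygies

variable {R : Type u} [CommRing R]

namespace syzygy

variable {X : ModuleCat.{u} R} (F : ProjectiveResolution X)

/-- The surjection `F_p → Ω_p`. -/
noncomputable def proj : ∀ p, F.complex.X p →ₗ[R] syzygy F p
  | 0 => (F.π.f 0).hom
  | p + 1 => (F.complex.d (p + 1) p).hom.rangeRestrict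

/-- The inclusion `Ω_{p+1} → F_p`. -/
noncomputable def incl (p : ℕ) : syzygy F (p + 1) →ₗ[R] F.complex.X p :=
  Submodule.subtype _

theorem incl_injective (p : ℕ) : Function.Injective (incl F p) :=
  Submodule.subtype_injective _

theorem proj_surjective : ∀ p, Function.Surjective (proj F p)
  | 0 => (ModuleCat.epi_iff_surjective (F.π.f 0)).mp inferInstance
  | _ + 1 => LinearMap.surjective_rangeRestrict _

theorem incl_comp_proj (p : ℕ) : incl F p ∘ₗ proj F (p + 1) = (F.complex.d (p + 1) p).hom := rfl

theorem exact_d_proj (p : ℕ) : Function.Exact (F.complex.d (p + 1) p).hom (proj F p) := by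
  cases p with
  | zero => exact (ShortComplex.ShortExact.moduleCat_exact_iff_function_exact _).mp F.exact₀
  | succ p =>
    have h := (ShortComplex.ShortExact.moduleCat_exact_iff_function_exact _).mp (F.exact_succ p)
    exact fun a ↦ Subtype.ext_iff.trans (h a)

theorem exact_incl_proj (p : ℕ) : Function.Exact (incl F p) (proj F p) := by
  have h := exact_d_proj F p
  rw [← incl_comp_proj] at h
  rwa [LinearMap.exact_iff, ← LinearMap.range_comp_of_range_eq_top (incl F p)
    (LinearMap.range_eq_top.mpr (proj_surjective F (p + 1))), ← LinearMap.exact_iff]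

end syzygy

theorem projective_of_projectiveResolution {X : ModuleCat.{u} R} (F : ProjectiveResolution X)
    (p : ℕ) : Module.Projective R (F.complex.X p) :=
  (IsProjective.iff_projective _).mpr (F.projective p)

theorem ExtMod.nonempty_syzygy_equiv {M : Type u} [AddCommGroup M] [Module R M]
    (F : ProjectiveResolution (ModuleCat.of R M)) (W : Type u) [AddCommGroup W] [Module R W]
    (i p : ℕ) : Nonempty (ExtMod R (i + 1) (syzygy F p) W ≃ₗ[R] ExtMod R (p + i + 1) M W) := by
  induction p generalizing i with
  | zero => rw [zero_add]; exact ⟨.refl R _⟩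
  | succ p ih =>
    have := projective_of_projectiveResolution F p
    obtain ⟨e⟩ := nonempty_dimensionShift (W := W) (syzygy.incl_injective F p)
      (syzygy.proj_surjective F p) (syzygy.exact_incl_proj F p)
      (subsingleton_of_projective i) (subsingleton_of_projective (i + 1))
    obtain ⟨e'⟩ := ih (i + 1)
    rw [Nat.add_right_comm p 1 i]
    exact ⟨e.trans e'⟩

theorem nonempty_homology_equiv_ker (S : ShortComplex (ModuleCat.{u} R)) {C : Type u}
    [AddCommGroup C] [Module R C] {q : S.X₂ →ₗ[R] C} {i : C →ₗ[R] S.X₃}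
    (hq : Function.Surjective q) (hex : Function.Exact S.f.hom q) (hi : i ∘ₗ q = S.g.hom) :
    Nonempty (S.homology ≃ₗ[R] LinearMap.ker i) := by
  let ψ : LinearMap.ker S.g.hom →ₗ[R] LinearMap.ker i := q.restrict fun a ha ↦ by
    rwa [LinearMap.mem_ker, ← LinearMap.comp_apply, hi]
  have hψ : Function.Surjective ψ := by
    rintro ⟨c, hc⟩
    obtain ⟨a, rfl⟩ := hq c
    exact ⟨⟨a, (LinearMap.congr_fun hi a).symm.trans hc⟩, rfl⟩
  have hker : LinearMap.range S.moduleCatToCycles = LinearMap.ker ψ := by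
    ext a
    rw [LinearMap.mem_ker, Subtype.ext_iff]
    refine Iff.trans ?_ (hex a.1).symm
    exact exists_congr fun b ↦ Subtype.ext_iff
  exact ⟨S.moduleCatHomologyIso.toLinearEquiv.trans
    ((Submodule.quotEquivOfEq _ _ hker).trans (ψ.quotKerEquivOfSurjective hψ))⟩

namespace TorMod

variable {M : Type u} [AddCommGroup M] [Module R M] (F : ProjectiveResolution (ModuleCat.of R M))
  (B : Type u) [AddCommGroup B] [Module R B]

theorem nonempty_equiv_ker {j k : ℕ} (hk : (ComplexShape.down ℕ).next j = k)
    {i : syzygy F j ⊗[R] B →ₗ[R] F.complex.X k ⊗[R] B}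
    (hi : i ∘ₗ (syzygy.proj F j).rTensor B = (F.complex.d j k).hom.rTensor B) :
    Nonempty (TorMod R j M B ≃ₗ[R] LinearMap.ker i) := by
  let T := (MonoidalCategory.tensoringRight (ModuleCat.{u} R)).obj (ModuleCat.of R B)
  let K := (T.mapHomologicalComplex _).obj F.complex
  obtain ⟨e⟩ := nonempty_homology_equiv_ker (K.sc' (j + 1) j k)
    (LinearMap.rTensor_surjective B (syzygy.proj_surjective F j))
    (rTensor_exact B (syzygy.exact_d_proj F j) (syzygy.proj_surjective F j)) hi
  exact ⟨((F.isoLeftDerivedObj T j).toLinearEquiv.trans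
    (K.homologyIsoSc' (j + 1) j k (by simp) hk).toLinearEquiv).trans e⟩

theorem nonempty_zero_equiv : Nonempty (TorMod R 0 M B ≃ₗ[R] M ⊗[R] B) := by
  let F := projectiveResolution (ModuleCat.of R M)
  obtain ⟨e⟩ := nonempty_equiv_ker F B (j := 0) (k := 0) (i := 0) (by simp) <| by
    rw [F.complex.shape 0 0 (by simp), ModuleCat.hom_zero, LinearMap.rTensor_zero,
      LinearMap.zero_comp]
  exact ⟨e.trans (LinearEquiv.ofTop _ LinearMap.ker_zero)⟩

theorem nonempty_succ_equiv (p : ℕ) :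
    Nonempty (TorMod R (p + 1) M B ≃ₗ[R] LinearMap.ker ((syzygy.incl F p).rTensor B)) :=
  nonempty_equiv_ker F B (by simp) <| by rw [← LinearMap.rTensor_comp, syzygy.incl_comp_proj]

end TorMod

end Syzygies

section RightExact

variable {R : Type u} [CommRing R] {Q P C L W : Type u} [AddCommGroup Q] [Module R Q]
  [AddCommGroup P] [Module R P] [AddCommGroup C] [Module R C] [AddCommGroup L] [Module R L]
  [AddCommGroup W] [Module R W] {f : Q →ₗ[R] P} {g : P →ₗ[R] C}

theorem exact_subtype_rangeRestrict (f : Q →ₗ[R] P) :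
    Function.Exact (LinearMap.ker f).subtype f.rangeRestrict := by
  rw [LinearMap.exact_iff, LinearMap.ker_rangeRestrict, Submodule.range_subtype]

theorem exact_subtype_range (h : Function.Exact f g) :
    Function.Exact (LinearMap.range f).subtype g := by
  rw [LinearMap.exact_iff, Submodule.range_subtype, LinearMap.exact_iff.mp h]

theorem IsExtAcyclic.range (h : Function.Exact f g) (hg : Function.Surjective g)
    (hP : IsExtAcyclic R P W) (hC : IsExtAcyclic R C W) :
    IsExtAcyclic R (LinearMap.range f) W :=
  .left (Submodule.subtype_injective _) hg (exact_subtype_range h) hP hC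

theorem IsExtAcyclic.of_ker (h : Function.Exact f g) (hg : Function.Surjective g)
    (hK : IsExtAcyclic R (LinearMap.ker f) W) (hP : IsExtAcyclic R P W)
    (hC : IsExtAcyclic R C W) : IsExtAcyclic R Q W :=
  .middle (Submodule.subtype_injective _) f.surjective_rangeRestrict
    (exact_subtype_rangeRestrict f) hK (.range h hg hP hC)

theorem GradeGE.congr {d : ℕ} (e : Q ≃ₗ[R] P) (h : GradeGE R d L Q) : GradeGE R d L P :=
  .left e.symm.injective (g := (0 : Q →ₗ[R] PUnit.{u + 1})) (fun _ ↦ ⟨0, Subsingleton.elim _ _⟩)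
    ((LinearMap.exact_zero_iff_surjective _ _).mpr e.symm.surjective) h
    fun i _ ↦ ExtMod.subsingleton_of_subsingleton_right i

theorem GradeGE.ker {d : ℕ} (h : Function.Exact f g) (hg : Function.Surjective g)
    (hQ : GradeGE R d L Q) (hP : GradeGE R d L P) (hC : GradeGE R d L C) :
    GradeGE R d L (LinearMap.ker f) := by
  refine .left (Submodule.subtype_injective _) f.surjective_rangeRestrict
    (exact_subtype_rangeRestrict f) hQ fun i hi ↦ ?_
  exact GradeGE.left (Submodule.subtype_injective _) hg (exact_subtype_range h) hP
    (fun i hi ↦ hC i (by omega)) i (by omega)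

theorem nonempty_quotient_range_lcomp_equiv (h : Function.Exact f g)
    (hg : Function.Surjective g) (hP : IsExtAcyclic R P W) (hC : IsExtAcyclic R C W) :
    Nonempty (((Q →ₗ[R] W) ⧸ LinearMap.range (f.lcomp R W)) ≃ₗ[R]
      (LinearMap.ker f →ₗ[R] W)) := by
  let ρ := (LinearMap.ker f).subtype.lcomp R W
  have hρ : Function.Surjective ρ :=
    ExtMod.exists_extension (Submodule.subtype_injective _) f.surjective_rangeRestrict
      (exact_subtype_rangeRestrict f) (IsExtAcyclic.range h hg hP hC 0)
  have hker : LinearMap.range (f.lcomp R W) = LinearMap.ker ρ := by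
    ext φ
    constructor
    · rintro ⟨θ, rfl⟩
      ext a
      exact (congr_arg θ a.2).trans (map_zero θ)
    · intro hφ
      obtain ⟨χ, rfl⟩ := (LinearMap.exact_lcomp_of_exact_of_surjective W
        (exact_subtype_rangeRestrict f) f.surjective_rangeRestrict φ).mp hφ
      obtain ⟨θ, rfl⟩ := ExtMod.exists_extension (Submodule.subtype_injective _) hg
        (exact_subtype_range h) (hC 0) χ
      exact ⟨θ, rfl⟩
  exact ⟨(Submodule.quotEquivOfEq _ _ hker).trans (ρ.quotKerEquivOfSurjective hρ)⟩

end RightExact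

section Comparison

variable {R : Type u} [CommRing R] {M N ω : Type u} [AddCommGroup M] [Module R M]
  [AddCommGroup N] [Module R N] [AddCommGroup ω] [Module R ω]

/-- For a reflexive module `N`, homomorphisms `P → N` are the same as forms on `P ⊗ N^∨`: this is
how `Ext` into `N` is compared with `Tor` against `N^∨`. -/
noncomputable def homEquivTensorDual (P : Type u) [AddCommGroup P] [Module R P]
    (hN : Function.Bijective (LinearMap.applyₗ : N →ₗ[R] (N →ₗ[R] ω) →ₗ[R] ω)) :
    (P →ₗ[R] N) ≃ₗ[R] (P ⊗[R] (N →ₗ[R] ω) →ₗ[R] ω) :=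
  ((LinearEquiv.refl R P).arrowCongr (LinearEquiv.ofBijective _ hN)).trans
    (TensorProduct.lift.equiv (RingHom.id R) P (N →ₗ[R] ω) ω)

theorem homEquivTensorDual_comp {P Q : Type u} [AddCommGroup P] [Module R P] [AddCommGroup Q]
    [Module R Q] (hN : Function.Bijective (LinearMap.applyₗ : N →ₗ[R] (N →ₗ[R] ω) →ₗ[R] ω))
    (φ : P →ₗ[R] N) (f : Q →ₗ[R] P) :
    homEquivTensorDual Q hN (φ ∘ₗ f) = homEquivTensorDual P hN φ ∘ₗ f.rTensor (N →ₗ[R] ω) :=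
  TensorProduct.ext' fun _ _ ↦ rfl

theorem map_homEquivTensorDual_range_lcomp {P Q : Type u} [AddCommGroup P] [Module R P]
    [AddCommGroup Q] [Module R Q]
    (hN : Function.Bijective (LinearMap.applyₗ : N →ₗ[R] (N →ₗ[R] ω) →ₗ[R] ω)) (f : Q →ₗ[R] P) :
    (LinearMap.range (f.lcomp R N)).map (homEquivTensorDual Q hN).toLinearMap =
      LinearMap.range ((f.rTensor (N →ₗ[R] ω)).lcomp R ω) := by
  have h : (homEquivTensorDual Q hN).toLinearMap ∘ₗ f.lcomp R N =
      (f.rTensor (N →ₗ[R] ω)).lcomp R ω ∘ₗ (homEquivTensorDual P hN).toLinearMap :=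
    LinearMap.ext fun φ ↦ homEquivTensorDual_comp hN φ f
  rw [← LinearMap.range_comp, h, LinearMap.range_comp_of_range_eq_top _ (LinearEquiv.range _)]

theorem IsExtAcyclic.syzygy_tensor {B W : Type u} [AddCommGroup B] [Module R B] [AddCommGroup W]
    [Module R W] (F : ProjectiveResolution (ModuleCat.of R M)) (hB : IsExtAcyclic R B W) {p : ℕ}
    (hTor : ∀ j ≤ p, IsExtAcyclic R (TorMod R j M B) W) :
    IsExtAcyclic R (syzygy F p ⊗[R] B) W := by
  induction p with
  | zero => exact (hTor 0 le_rfl).congr (TorMod.nonempty_zero_equiv B).some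
  | succ p ih =>
    have := projective_of_projectiveResolution F p
    exact .of_ker (rTensor_exact B (syzygy.exact_incl_proj F p) (syzygy.proj_surjective F p))
      (LinearMap.rTensor_surjective B (syzygy.proj_surjective F p))
      ((hTor (p + 1) le_rfl).congr (TorMod.nonempty_succ_equiv F B p).some)
      hB.tensor (ih fun j hj ↦ hTor j (by omega))

theorem ExtMod.nonempty_zero_equiv_tor_dual
    (hN : Function.Bijective (LinearMap.applyₗ : N →ₗ[R] (N →ₗ[R] ω) →ₗ[R] ω)) :
    Nonempty (ExtMod R 0 M N ≃ₗ[R] (TorMod R 0 M (N →ₗ[R] ω) →ₗ[R] ω)) := by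
  obtain ⟨e⟩ := TorMod.nonempty_zero_equiv (R := R) (M := M) (N →ₗ[R] ω)
  exact ⟨(zeroEquiv.trans (homEquivTensorDual M hN)).trans
    (e.symm.arrowCongr (LinearEquiv.refl R ω))⟩

theorem ExtMod.nonempty_one_equiv_ker_rTensor_dual {A P C : Type u} [AddCommGroup A] [Module R A]
    [AddCommGroup P] [Module R P] [AddCommGroup C] [Module R C] [Module.Projective R P]
    {f : A →ₗ[R] P} {g : P →ₗ[R] C} (hf : Function.Injective f) (hg : Function.Surjective g)
    (h : Function.Exact f g)
    (hN : Function.Bijective (LinearMap.applyₗ : N →ₗ[R] (N →ₗ[R] ω) →ₗ[R] ω))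
    (hB : IsExtAcyclic R (N →ₗ[R] ω) ω) (hC : IsExtAcyclic R (C ⊗[R] (N →ₗ[R] ω)) ω) :
    Nonempty (ExtMod R 1 C N ≃ₗ[R]
      (LinearMap.ker (f.rTensor (N →ₗ[R] ω)) →ₗ[R] ω)) := by
  obtain ⟨e⟩ := nonempty_one_equiv_quotient_range_lcomp (W := N) hf hg h
    (subsingleton_of_projective 0)
  obtain ⟨e'⟩ := nonempty_quotient_range_lcomp_equiv (rTensor_exact _ h hg)
    (LinearMap.rTensor_surjective _ hg) hB.tensor hC
  exact ⟨(e.trans (Submodule.Quotient.equiv _ _ _ (map_homEquivTensorDual_range_lcomp hN f))).trans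
    e'⟩

theorem ExtMod.nonempty_equiv_tor_dual
    (hN : Function.Bijective (LinearMap.applyₗ : N →ₗ[R] (N →ₗ[R] ω) →ₗ[R] ω))
    (hB : IsExtAcyclic R (N →ₗ[R] ω) ω) {n : ℕ}
    (hTor : ∀ j < n, IsExtAcyclic R (TorMod R j M (N →ₗ[R] ω)) ω) :
    Nonempty (ExtMod R n M N ≃ₗ[R] (TorMod R n M (N →ₗ[R] ω) →ₗ[R] ω)) := by
  cases n with
  | zero => exact nonempty_zero_equiv_tor_dual hN
  | succ p =>
    let F := projectiveResolution (ModuleCat.of R M)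
    have := projective_of_projectiveResolution F p
    obtain ⟨e⟩ := nonempty_syzygy_equiv F N 0 p
    obtain ⟨e'⟩ := nonempty_one_equiv_ker_rTensor_dual (syzygy.incl_injective F p)
      (syzygy.proj_surjective F p) (syzygy.exact_incl_proj F p) hN hB
      (.syzygy_tensor F hB fun j hj ↦ hTor j (by omega))
    obtain ⟨e''⟩ := TorMod.nonempty_succ_equiv F (N →ₗ[R] ω) p
    exact ⟨(e.symm.trans e').trans (e''.symm.arrowCongr (LinearEquiv.refl R ω))⟩

end Comparison

section TorDepth

variable {R : Type u} [CommRing R] [IsLocalRing R] [IsNoetherianRing R]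

theorem GradeGE.tensor {P B : Type u} [AddCommGroup P] [Module R P] [AddCommGroup B] [Module R B]
    [Module.Flat R P] [Module.Finite R B] {d : ℕ} (hB : GradeGE R d (ResidueField R) B) :
    GradeGE R d (ResidueField R) (P ⊗[R] B) := by
  obtain ⟨rs, rfl, hm, hr⟩ := exists_isWeaklyRegular_iff_gradeGE.mpr hB
  exact .of_isWeaklyRegular (by rwa [annihilator_residueField]) hr.isWeaklyRegular_lTensor

theorem IsMCM.torMod {M B : Type u} [AddCommGroup M] [Module R M] [AddCommGroup B] [Module R B]
    [Module.Finite R B] {d : ℕ} (hd : ringKrullDim R = d)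
    (hB : GradeGE R d (ResidueField R) B) (F : ProjectiveResolution (ModuleCat.of R M)) {p : ℕ}
    (h : IsMCM R (syzygy F p ⊗[R] B)) (h' : IsMCM R (syzygy F (p + 1) ⊗[R] B))
    [Nontrivial (TorMod R (p + 1) M B)] : IsMCM R (TorMod R (p + 1) M B) := by
  have := h.finite
  have := h'.finite
  have := projective_of_projectiveResolution F p
  obtain ⟨e⟩ := TorMod.nonempty_succ_equiv F B p
  have := Module.Finite.equiv e.symm
  refine (isMCM_iff hd).mpr ⟨inferInstance, .congr e.symm ?_⟩
  exact .ker (rTensor_exact B (syzygy.exact_incl_proj F p) (syzygy.proj_surjective F p))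
    (LinearMap.rTensor_surjective B (syzygy.proj_surjective F p))
    ((isMCM_iff hd).mp h').2 hB.tensor ((isMCM_iff hd).mp h).2

end TorDepth

namespace IsCanonicalModule

variable {R : Type u} [CommRing R] [IsLocalRing R] {ω X M N : Type u} [AddCommGroup ω]
  [Module R ω] [AddCommGroup X] [Module R X] [AddCommGroup M] [Module R M] [AddCommGroup N]
  [Module R N] (hR : IsCMLocalRing R) (hω : IsCanonicalModule R ω)

include hR hω

theorem isExtAcyclic_of_isMCM (hX : IsMCM R X) : IsExtAcyclic R X ω := by
  have := hR.noetherian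
  have := hX.finite
  obtain ⟨d, hd, -⟩ := hω.type_eq_one
  exact hω.isExtAcyclic hR hd ((isMCM_iff hd).mp hX).2

theorem nontrivial_dual (hX : IsMCM R X) : Nontrivial (X →ₗ[R] ω) := by
  have := hR.noetherian
  have := hX.finite
  obtain ⟨d, hd, -⟩ := hω.type_eq_one
  obtain ⟨_, hX'⟩ := (isMCM_iff hd).mp hX
  have := (hω.applyₗ_bijective hR hd hX').1.nontrivial
  by_contra h
  rw [not_nontrivial_iff_subsingleton] at h
  exact not_subsingleton ((X →ₗ[R] ω) →ₗ[R] ω) inferInstance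

theorem nonempty_ext_equiv_tor_dual (hN : IsMCM R N) {n : ℕ}
    (hTor : ∀ j < n, Subsingleton (TorMod R j M (N →ₗ[R] ω)) ∨
      IsMCM R (TorMod R j M (N →ₗ[R] ω))) :
    Nonempty (ExtMod R n M N ≃ₗ[R] (TorMod R n M (N →ₗ[R] ω) →ₗ[R] ω)) := by
  have := hR.noetherian
  have := hN.finite
  have := hω.isMCM.finite
  obtain ⟨d, hd, -⟩ := hω.type_eq_one
  have hN' := ((isMCM_iff hd).mp hN).2
  exact ExtMod.nonempty_equiv_tor_dual (hω.applyₗ_bijective hR hd hN')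
    (hω.isExtAcyclic hR hd (hω.gradeGE_dual hR hd hN')) fun j hj ↦
      (hTor j hj).elim (fun _ ↦ .of_subsingleton) (hω.isExtAcyclic_of_isMCM hR)

theorem isMCM_torMod (hN : IsMCM R N) (F : ProjectiveResolution (ModuleCat.of R M)) {p : ℕ}
    (h : IsMCM R (syzygy F p ⊗[R] (N →ₗ[R] ω)))
    (h' : IsMCM R (syzygy F (p + 1) ⊗[R] (N →ₗ[R] ω)))
    [Nontrivial (TorMod R (p + 1) M (N →ₗ[R] ω))] :
    IsMCM R (TorMod R (p + 1) M (N →ₗ[R] ω)) := by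
  have := hR.noetherian
  have := hN.finite
  have := hω.isMCM.finite
  obtain ⟨d, hd, -⟩ := hω.type_eq_one
  exact .torMod hd (hω.gradeGE_dual hR hd ((isMCM_iff hd).mp hN).2) F h h'

end IsCanonicalModule

theorem mainTheorem6_general (R : Type u) [CommRing R] [IsLocalRing R] (hR : IsCMLocalRing R)
    (ω : Type u) [AddCommGroup ω] [Module R ω] (hω : IsCanonicalModule R ω)
    (M : Type u) [AddCommGroup M] [Module R M]
    (N : Type u) [AddCommGroup N] [Module R N] (hN : IsMCM R N)
    (n : ℕ) (hn : 1 ≤ n)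
    (hTor : ∀ j < n, Subsingleton (TorMod R j M (N →ₗ[R] ω)) ∨
      IsMCM R (TorMod R j M (N →ₗ[R] ω))) :
    (Subsingleton (TorMod R n M (N →ₗ[R] ω)) →
      Subsingleton (ExtMod R n M N) ∧
      Nonempty (ExtMod R (n + 1) M N ≃ₗ[R] (TorMod R (n + 1) M (N →ₗ[R] ω) →ₗ[R] ω))) ∧
    (Nontrivial (TorMod R n M (N →ₗ[R] ω)) →
      ∀ F : ProjectiveResolution (ModuleCat.of R M),
      IsMCM R (syzygy F (n - 1) ⊗[R] (N →ₗ[R] ω)) →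
      IsMCM R (syzygy F n ⊗[R] (N →ₗ[R] ω)) →
      IsMCM R (TorMod R n M (N →ₗ[R] ω)) ∧
      (∀ j ≤ n + 1,
        Nonempty (ExtMod R j M N ≃ₗ[R] (TorMod R j M (N →ₗ[R] ω) →ₗ[R] ω))) ∧
      Nontrivial (ExtMod R n M N)) := by
  obtain ⟨e⟩ := hω.nonempty_ext_equiv_tor_dual hR hN hTor
  have hTor_succ (h : Subsingleton (TorMod R n M (N →ₗ[R] ω)) ∨
      IsMCM R (TorMod R n M (N →ₗ[R] ω))) : ∀ j < n + 1,
      Subsingleton (TorMod R j M (N →ₗ[R] ω)) ∨ IsMCM R (TorMod R j M (N →ₗ[R] ω)) :=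
    Nat.forall_lt_succ_right.mpr ⟨hTor, h⟩
  refine ⟨fun hzero ↦ ⟨e.subsingleton,
    hω.nonempty_ext_equiv_tor_dual hR hN (hTor_succ (.inl hzero))⟩, fun _ F h h' ↦ ?_⟩
  have hMCM : IsMCM R (TorMod R n M (N →ₗ[R] ω)) := by
    obtain ⟨p, rfl⟩ := Nat.exists_eq_add_of_le' hn
    exact hω.isMCM_torMod hR hN F h h'
  have := hω.nontrivial_dual hR hMCM
  exact ⟨hMCM, fun j hj ↦ hω.nonempty_ext_equiv_tor_dual hR hN fun i hi ↦
    hTor_succ (.inr hMCM) i (by omega), e.nontrivial⟩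

theorem mainTheorem6 (R : Type u) [CommRing R] [IsLocalRing R] (hR : IsCMLocalRing R)
    (ω : Type u) [AddCommGroup ω] [Module R ω] (hω : IsCanonicalModule R ω)
    (M : Type u) [AddCommGroup M] [Module R M] (hM : Module.Finite R M)
    (N : Type u) [AddCommGroup N] [Module R N] (hN : IsMCM R N)
    (n : ℕ) (hn : 1 ≤ n)
    (hTor : ∀ j < n, Subsingleton (TorMod R j M (N →ₗ[R] ω)) ∨
      IsMCM R (TorMod R j M (N →ₗ[R] ω))) :
    (Subsingleton (TorMod R n M (N →ₗ[R] ω)) →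
      Subsingleton (ExtMod R n M N) ∧
      Nonempty (ExtMod R (n + 1) M N ≃ₗ[R] (TorMod R (n + 1) M (N →ₗ[R] ω) →ₗ[R] ω))) ∧
    (Nontrivial (TorMod R n M (N →ₗ[R] ω)) →
      ∀ F : ProjectiveResolution (ModuleCat.of R M), IsMinimalFreeResolution F →
      IsMCM R (syzygy F (n - 1) ⊗[R] (N →ₗ[R] ω)) →
      IsMCM R (syzygy F n ⊗[R] (N →ₗ[R] ω)) →
      IsMCM R (TorMod R n M (N →ₗ[R] ω)) ∧
      (∀ j ≤ n + 1,
        Nonempty (ExtMod R j M N ≃ₗ[R] (TorMod R j M (N →ₗ[R] ω) →ₗ[R] ω))) ∧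
      Nontrivial (ExtMod R n M N)) := by
  have key := mainTheorem6_general R hR ω hω M N hN n hn hTor
  exact ⟨key.1, fun hne F _ ↦ key.2 hne F⟩
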